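/- Consider the periodic box $\mathbb T^3=\mathbb R^3/\mathbb Z^3$. Let $s\ge 3$ be real and let $u_0\in H^s(\mathbb T^3;\mathbb R^3)$ satisfy $\nabla\cdot u_0=0$. For $\alpha>0$ let $u^\alpha\in C([0,\infty);H^1)$ be the unique solution of the 3D Euler–Voigt equations $$-\alpha^2\partial_t\Delta u+\partial_t u+(u\cdot\nabla)u+\nabla p=0,\qquad \nabla\cdot u=0,\qquad u(\cdot,0)=u_0$$ on $\mathbb T^3$. Suppose that for some $T>0$ $$\limsup_{\alpha\to0^+}\ \sup_{t\in[0,T]}\ \alpha\,\|\nabla u^\alpha(t)\|_{L^2(\mathbb T^3)}>0 .$$ Then the strong solution of the 3D Euler equations (the same system with $\alpha=0$) with initial data $u_0$ develops a singularity within $[0,T]$: there is no solution $u\in C([0,T];H^3(\mathbb T^3))$ of the Euler equations on $[0,T]$ with $u(0)=u_0$, that is, the maximal time of existence of the strong solution is at most $T$. -/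

import Mathlib

open MeasureTheory Filter Topology Set
open scoped ENNReal ContDiff

noncomputable section

namespace EulerVoigt

/-- The periodic box `ℝ³/ℤ³`. -/
abbrev Torus : Type := UnitAddTorus (Fin 3)

/-- Euclidean space `ℝ³`, in which velocities take their values. -/
abbrev R3 : Type := EuclideanSpace ℝ (Fin 3)

/-- Lebesgue measure on the periodic box: the product of the three Haar measures of mass one.
It is the measure used by Mathlib's Fourier coefficients `UnitAddTorus.mFourierCoeff`. -/
def torusMeasure : Measure Torus := Measure.pi fun _ => AddCircle.haarAddCircle

/-- Square integrable real vector fields on the periodic box, modulo a.e. equality. -/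
abbrev L2Field : Type := Lp R3 2 torusMeasure

/-! ### Sobolev norms -/

/-- `∑ᵢ |ûᵢ(k)|²`, where `ûᵢ(k) = ∫ uᵢ(x) exp(-2πi k·x) dx`. -/
def fourierSq (u : L2Field) (k : Fin 3 → ℤ) : ℝ≥0∞ :=
  ∑ i : Fin 3, ‖UnitAddTorus.mFourierCoeff (fun x : Torus => ((u x i : ℝ) : ℂ)) k‖ₑ ^ 2

/-- `4π²|k|²`, the eigenvalue of `-Δ` on the Fourier mode `exp(2πi k·x)`. -/
def laplaceEigenvalue (k : Fin 3 → ℤ) : ℝ := 4 * Real.pi ^ 2 * ∑ j : Fin 3, (k j : ℝ) ^ 2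

/-- The norm of the Sobolev space `Hˢ`, for real `s`, with the value `∞` outside of `Hˢ`. -/
def sobolevNorm (s : ℝ) (u : L2Field) : ℝ≥0∞ :=
  (∑' k : Fin 3 → ℤ, ENNReal.ofReal ((1 + laplaceEigenvalue k) ^ s) * fourierSq u k) ^ (1 / 2 : ℝ)

/-- `u` belongs to the Sobolev space `Hˢ`. -/
def MemSobolev (s : ℝ) (u : L2Field) : Prop := sobolevNorm s u < ⊤

/-- `‖∇u‖_{L²}`, with the value `∞` outside of `H¹`; by Plancherel, the square of the
`L²` norm of `∂ⱼuᵢ` is `∑ₖ (2πkⱼ)² |ûᵢ(k)|²`. -/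
def gradNorm (u : L2Field) : ℝ≥0∞ :=
  (∑' k : Fin 3 → ℤ, ENNReal.ofReal (laplaceEigenvalue k) * fourierSq u k) ^ (1 / 2 : ℝ)

/-! ### Smooth periodic test functions -/

/-- Smooth functions on the torus: those whose periodic lift to `ℝ³` is smooth. -/
def IsSmooth {F : Type*} [NormedAddCommGroup F] [NormedSpace ℝ F] (f : Torus → F) : Prop :=
  ContDiff ℝ ∞ fun y : Fin 3 → ℝ => f fun i => (y i : UnitAddCircle)

/-- The partial derivative `∂ⱼf`. -/
def partialDeriv {F : Type*} [NormedAddCommGroup F] [NormedSpace ℝ F]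
    (j : Fin 3) (f : Torus → F) (x : Torus) : F :=
  deriv (fun h : ℝ => f (x + Pi.single j (h : UnitAddCircle))) 0

/-- The Laplacian `Δf = ∑ⱼ ∂ⱼ∂ⱼf`. -/
def laplacian {F : Type*} [NormedAddCommGroup F] [NormedSpace ℝ F]
    (f : Torus → F) (x : Torus) : F :=
  ∑ j : Fin 3, partialDeriv j (partialDeriv j f) x

/-- Test fields: smooth periodic vector fields with `∇ · φ = 0`. -/
structure IsTestField (φ : Torus → R3) : Prop where
  smooth : IsSmooth φ
  divFree : ∀ x, ∑ j : Fin 3, partialDeriv j φ x j = 0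

/-- `∇ · u = 0` in the sense of distributions: `∫ u · ∇ψ = 0` for all smooth periodic `ψ`. -/
def IsDivFree (u : L2Field) : Prop :=
  ∀ ψ : Torus → ℝ, IsSmooth ψ →
    ∫ x, ∑ j : Fin 3, u x j * partialDeriv j ψ x ∂torusMeasure = 0

/-! ### The equations -/

/-- `u` is a solution of class `C([0,T]; Hˢ)` of
`-α² ∂ₜΔu + ∂ₜu + (u·∇)u + ∇p = 0`, `∇·u = 0`, `u(0) = u₀` on the periodic box. The pressure is
eliminated in the usual way, by testing with divergence-free fields `φ`, and all space derivatives
are moved to `φ`: since `∫ u·φ + α² ∫ ∇u:∇φ = ∫ u·(φ - α²Δφ)` and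
`-∫ (u·∇)u·φ = ∫ u·(u·∇)φ`, the equation becomes
`d/dt ∫ u·(φ - α²Δφ) = ∫ u·(u·∇)φ` at every time in `[0,T]` (one-sided at the end points). -/
structure IsSolution (α s T : ℝ) (u₀ : L2Field) (u : ℝ → L2Field) : Prop where
  initial : u 0 = u₀
  divFree : ∀ t ∈ Icc 0 T, IsDivFree (u t)
  mem : ∀ t ∈ Icc 0 T, MemSobolev s (u t)
  cont : ∀ t₀ ∈ Icc 0 T,
    Tendsto (fun t => sobolevNorm s (u t - u t₀)) (𝓝[Icc 0 T] t₀) (𝓝 0)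
  momentum : ∀ φ : Torus → R3, IsTestField φ → ∀ t ∈ Icc 0 T,
    HasDerivWithinAt
      (fun τ => ∫ x, inner ℝ (u τ x) (φ x - α ^ 2 • laplacian φ x) ∂torusMeasure)
      (∫ x, ∑ j : Fin 3, u t x j * inner ℝ (u t x) (partialDeriv j φ x) ∂torusMeasure)
      (Icc 0 T) t

/-- `u` solves the Euler-Voigt equations with parameter `α` on `[0,T]`; the class is
`C([0,T]; H¹)`, in which the equations are well posed. -/
def IsEulerVoigtSolution (α T : ℝ) (u₀ : L2Field) (u : ℝ → L2Field) : Prop :=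
  IsSolution α 1 T u₀ u

/-- `u` is a strong solution of the Euler equations (the case `α = 0`) on `[0,T]`, that is, a
solution of class `C([0,T]; H³)`. -/
def IsStrongEulerSolution (T : ℝ) (u₀ : L2Field) (u : ℝ → L2Field) : Prop :=
  IsSolution 0 3 T u₀ u

/-- The Euler equations with initial data `u₀` develop a singularity within `[0,T]`: the strong
solution does not persist on all of `[0,T]`, so that its maximal time of existence is at most
`T`. As `Hˢ ⊆ H³` for `s ≥ 3`, this also excludes solutions of class `C([0,T]; Hˢ)` and smooth
ones. -/
def DevelopsSingularityWithin (u₀ : L2Field) (T : ℝ) : Prop :=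
  ¬ ∃ u : ℝ → L2Field, IsStrongEulerSolution T u₀ u

end EulerVoigt

end

/-! As long as a strong Euler solution v exists on [0,T], the gradients of the Euler–Voigt solutions
u are bounded uniformly in α (`exists_gradNorm_le`). Then α‖∇u‖ tends to 0, which contradicts the
positive limsup.

The bound comes from the relative energy G = ‖u-v‖² + α²‖∇u‖² - 2α²⟨∇u,∇v⟩. Voigt conserves ‖u‖² +
α²‖∇u‖² and Euler conserves ‖v‖², so only cross terms contribute to G'. One is quadratic in u-v with
the derivative on v and is controlled by ‖u-v‖² (`enorm_transport_le_of_sobolev_three`). The other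
pairs (v·∇)v with α²Δu and costs a multiple of α²‖v‖²‖∇u‖, with v measured in H³
(`enorm_transport_laplacian_sq_le`). Hence G' ≤ AG + α²E, where A and E depend only on the H³ bound
for v. Both solutions start from u₀, so G(0) ≤ 0; Gronwall gives G ≤ Cα², and division by α² bounds
‖∇u‖.

Since u is only in H¹ and the equations are weak, the argument runs on a finite set S of
frequencies, where each Fourier mode obeys an ODE. Truncation spoils the cancellations of the
transport term, but the errors are governed by the tail of ∑(1+4π²|k|²)⁻². The set S is chosen after
α and u so that they are at most α² (`exists_negligibleTails`). -/

noncomputable section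

namespace EulerVoigt

/-- A frequency `k ∈ ℤ³`. -/
abbrev Freq : Type := Fin 3 → ℤ

/-! ### Sums of nonnegative sequences over the frequency lattice -/

/-- The Cauchy–Schwarz inequality for sums in `[0, ∞]`. -/
lemma tsum_sq_le_of_sq_le {ι : Type*} {f a b : ι → ℝ≥0∞} (h : ∀ i, f i ^ 2 ≤ a i * b i) :
    (∑' i, f i) ^ 2 ≤ (∑' i, a i) * ∑' i, b i := by
  -- For the counting measure sums are integrals, and the claim is Hölder's inequality with p = q =
  -- 2 for √a and √b.
  let _ : MeasurableSpace ι := ⊤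
  have hroot : ∀ x : ℝ≥0∞, (x ^ (1 / 2 : ℝ)) ^ (2 : ℝ) = x := fun x => by
    rw [← ENNReal.rpow_mul]; norm_num
  have hf : ∀ i, f i ≤ (fun i => a i ^ (1 / 2 : ℝ)) i * (fun i => b i ^ (1 / 2 : ℝ)) i := by
    intro i
    have := ENNReal.rpow_le_rpow (h i) (by norm_num : (0 : ℝ) ≤ 1 / 2)
    rw [ENNReal.mul_rpow_of_nonneg _ _ (by norm_num), ← ENNReal.rpow_natCast,
      ← ENNReal.rpow_mul] at this
    simpa using this
  have key := ENNReal.lintegral_mul_le_Lp_mul_Lq (Measure.count : Measure ι)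
    Real.HolderConjugate.two_two (f := fun i => a i ^ (1 / 2 : ℝ))
    (g := fun i => b i ^ (1 / 2 : ℝ)) measurable_from_top.aemeasurable
    measurable_from_top.aemeasurable
  simp only [lintegral_count, Pi.mul_apply, hroot] at key
  calc (∑' i, f i) ^ 2
      ≤ ((∑' i, a i) ^ (1 / 2 : ℝ) * (∑' i, b i) ^ (1 / 2 : ℝ)) ^ 2 := by
        gcongr
        exact (ENNReal.tsum_le_tsum hf).trans key
    _ = _ := by
        rw [mul_pow, ← ENNReal.rpow_two, ← ENNReal.rpow_two, hroot, hroot]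

/-- `1 + 4π²|k|²`. -/
def weight (k : Freq) : ℝ≥0∞ := ENNReal.ofReal (1 + laplaceEigenvalue k)

lemma laplaceEigenvalue_nonneg (k : Freq) : 0 ≤ laplaceEigenvalue k := by
  unfold laplaceEigenvalue
  positivity

lemma one_le_weight (k : Freq) : 1 ≤ weight k := by
  rw [weight, ← ENNReal.ofReal_one]
  exact ENNReal.ofReal_le_ofReal (by linarith [laplaceEigenvalue_nonneg k])

lemma weight_ne_zero (k : Freq) : weight k ≠ 0 :=
  (zero_lt_one.trans_le (one_le_weight k)).ne'

lemma weight_ne_top (k : Freq) : weight k ≠ ⊤ := ENNReal.ofReal_ne_top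

lemma ofReal_laplaceEigenvalue_le_weight (k : Freq) :
    ENNReal.ofReal (laplaceEigenvalue k) ≤ weight k :=
  ENNReal.ofReal_le_ofReal (by linarith)

/-- The frequencies l and -k-l add up to -k, so this is |x+y|² ≤ 2|x|² + 2|y|². It replaces the
product rule for 1-Δ: the weight is shared between the two factors of a convolution. -/
lemma weight_sub_le (k l : Freq) : weight k ≤ 2 * weight l + 2 * weight (-k - l) := by
  have h2 : (2 : ℝ≥0∞) = ENNReal.ofReal 2 := by simp
  have h : ∀ x y : ℝ, x ^ 2 ≤ 2 * y ^ 2 + 2 * (-x - y) ^ 2 := fun x y => by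
    nlinarith [sq_nonneg (x + 2 * y)]
  rw [weight, weight, weight, h2, ← ENNReal.ofReal_mul (by norm_num),
    ← ENNReal.ofReal_mul (by norm_num), ← ENNReal.ofReal_add]
  · apply ENNReal.ofReal_le_ofReal
    have hs : (∑ j : Fin 3, (k j : ℝ) ^ 2) ≤
        2 * (∑ j : Fin 3, (l j : ℝ) ^ 2) + 2 * ∑ j : Fin 3, (((-k - l) j : ℤ) : ℝ) ^ 2 := by
      rw [Finset.mul_sum, Finset.mul_sum, ← Finset.sum_add_distrib]
      refine Finset.sum_le_sum fun j _ => ?_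
      simpa using h (k j) (l j)
    have hpi : 0 ≤ 4 * Real.pi ^ 2 := by positivity
    unfold laplaceEigenvalue
    nlinarith [mul_le_mul_of_nonneg_left hs hpi]
  · linarith [laplaceEigenvalue_nonneg l]
  · linarith [laplaceEigenvalue_nonneg (-k - l)]

/-- The sum of `(1 + 4π²|k|²)⁻²` over the frequencies outside of `S`. -/
def latticeTail (S : Finset Freq) : ℝ≥0∞ := ∑' k, if k ∈ S then 0 else (weight k)⁻¹ ^ 2

lemma latticeTail_anti {S S' : Finset Freq} (h : S ⊆ S') : latticeTail S' ≤ latticeTail S := by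
  refine ENNReal.tsum_le_tsum fun k => ?_
  by_cases hk : k ∈ S
  · simp [hk, h hk]
  · by_cases hk' : k ∈ S' <;> simp [hk, hk']

/-- The convolution `∑ₗ F(l) G(-k-l)` that majorizes the Fourier modes of a product. -/
def majorant (F G : Freq → ℝ≥0∞) (k : Freq) : ℝ≥0∞ := ∑' l, F l * G (-k - l)

/-- In a trilinear term the three frequencies sum to zero, so convolutions pair l with -k-l; this
reflection is an involution of the lattice. -/
lemma tsum_reflect (k : Freq) (f : Freq → ℝ≥0∞) : ∑' l, f (-k - l) = ∑' l, f l :=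
  (Equiv.subLeft (-k)).tsum_eq f

lemma majorant_comm (F G : Freq → ℝ≥0∞) (k : Freq) : majorant F G k = majorant G F k := by
  unfold majorant
  rw [← tsum_reflect k]
  refine tsum_congr fun l => ?_
  rw [mul_comm, sub_sub_cancel]

lemma majorant_sq_le (F G : Freq → ℝ≥0∞) (k : Freq) :
    majorant F G k ^ 2 ≤ (∑' l, F l ^ 2) * ∑' l, G l ^ 2 := by
  rw [← tsum_reflect k (fun l => G l ^ 2)]
  exact tsum_sq_le_of_sq_le fun l => (mul_pow _ _ _).le

/-- Cauchy–Schwarz after inserting the weights of l and -k-l and their inverses. A second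
Cauchy–Schwarz bounds the sum of the inverse weights by c; frequencies with -k-l in S drop out
because G vanishes there. -/
lemma majorant_sq_le_weighted {S : Finset Freq} {F G : Freq → ℝ≥0∞} (hG : ∀ l ∈ S, G l = 0)
    {c : ℝ≥0∞} (hc : latticeTail ∅ * latticeTail S ≤ c ^ 2) (k : Freq) :
    majorant F G k ^ 2 ≤
      c * ∑' l, (weight l * F l ^ 2) * (weight (-k - l) * G (-k - l) ^ 2) := by
  have hsum : ∑' l, (weight l)⁻¹ * (if -k - l ∈ S then 0 else (weight (-k - l))⁻¹) ≤ c := by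
    rw [← ENNReal.pow_le_pow_left_iff two_ne_zero]
    refine le_trans ?_ hc
    rw [latticeTail, latticeTail, ← tsum_reflect k (fun l => if l ∈ S then 0 else _)]
    refine tsum_sq_le_of_sq_le fun l => ?_
    split_ifs <;> simp_all [mul_pow]
  refine le_trans (tsum_sq_le_of_sq_le fun l => ?_) (mul_le_mul_left hsum _)
  split_ifs with h
  · simp [hG _ h]
  · have e : ∀ a b x y : ℝ≥0∞, a⁻¹ * b⁻¹ * (a * x * (b * y)) = (a⁻¹ * a) * (b⁻¹ * b) * (x * y) :=
      fun a b x y => by ring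
    rw [e, ENNReal.inv_mul_cancel (weight_ne_zero _) (weight_ne_top _),
      ENNReal.inv_mul_cancel (weight_ne_zero _) (weight_ne_top _), mul_pow, one_mul, one_mul]

/-- The trilinear estimate `|∫ f g h| ≤ C ‖f‖_{H¹} ‖g‖_{H¹} ‖h‖_{L²}` for Fourier modes, with a
small constant when the modes of `g` in `S` vanish. -/
lemma tsum_mul_majorant_sq_le {S : Finset Freq} {d F G : Freq → ℝ≥0∞} (hG : ∀ l ∈ S, G l = 0)
    {c : ℝ≥0∞} (hc : latticeTail ∅ * latticeTail S ≤ c ^ 2) :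
    (∑' k, d k * majorant F G k) ^ 2 ≤
      c * (∑' k, d k ^ 2) * (∑' l, weight l * F l ^ 2) * ∑' l, weight l * G l ^ 2 := by
  have hdouble : ∑' k, ∑' l, (weight l * F l ^ 2) * (weight (-k - l) * G (-k - l) ^ 2) =
      (∑' l, weight l * F l ^ 2) * ∑' l, weight l * G l ^ 2 := by
    rw [ENNReal.tsum_comm, ← ENNReal.tsum_mul_right]
    refine tsum_congr fun l => ?_
    rw [ENNReal.tsum_mul_left, ← tsum_reflect l (fun l => weight l * G l ^ 2)]
    congr 1
    refine tsum_congr fun k => ?_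
    rw [neg_sub_comm]
  refine (tsum_sq_le_of_sq_le (a := fun k => d k ^ 2) (b := fun k =>
    c * ∑' l, (weight l * F l ^ 2) * (weight (-k - l) * G (-k - l) ^ 2)) fun k => ?_).trans ?_
  · rw [mul_pow]
    gcongr
    exact majorant_sq_le_weighted hG hc k
  · rw [ENNReal.tsum_mul_left, hdouble]
    exact le_of_eq (by ring)

/-- The exponent -2/3 is a third of -2: the lattice sum of (1+4π²|k|²)⁻² is dominated by a product
of three such series, each convergent because 4/3 > 1. -/
lemma summable_rpow_int : Summable fun n : ℤ => (1 + (n : ℝ) ^ 2) ^ (-(2 / 3) : ℝ) := by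
  have h1 : Summable fun n : ℤ => |(n : ℝ)| ^ (-(4 / 3) : ℝ) := by
    simpa using Real.summable_abs_int_rpow (b := 4 / 3) (by norm_num)
  refine Summable.of_norm_bounded_eventually h1 ?_
  filter_upwards [(Set.finite_singleton (0 : ℤ)).compl_mem_cofinite] with n hn
  have hn : n ≠ 0 := hn
  have hn' : 0 < |(n : ℝ)| := abs_pos.2 (by exact_mod_cast hn)
  rw [Real.norm_of_nonneg (by positivity)]
  have e : |(n : ℝ)| ^ (-(4 / 3) : ℝ) = ((n : ℝ) ^ 2) ^ (-(2 / 3) : ℝ) := by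
    rw [← sq_abs, ← Real.rpow_natCast, ← Real.rpow_mul hn'.le]
    norm_num
  rw [e]
  exact Real.rpow_le_rpow_of_nonpos (by positivity) (by linarith) (by norm_num)

lemma latticeTail_empty_ne_top : latticeTail ∅ ≠ ⊤ := by
  set g : ℤ → ℝ≥0∞ := fun n => ENNReal.ofReal ((1 + (n : ℝ) ^ 2) ^ (-(2 / 3) : ℝ)) with hg
  have hgsum : ∑' n, g n ≠ ⊤ := summable_rpow_int.tsum_ofReal_ne_top
  have hle : ∀ k : Freq, (weight k)⁻¹ ^ 2 ≤ g (k 0) * (g (k 1) * g (k 2)) := by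
    intro k
    have hb : ∀ j : Fin 3, 1 + (k j : ℝ) ^ 2 ≤ 1 + laplaceEigenvalue k := by
      intro j
      have h1 : (k j : ℝ) ^ 2 ≤ ∑ j : Fin 3, (k j : ℝ) ^ 2 :=
        Finset.single_le_sum (f := fun j => (k j : ℝ) ^ 2) (fun _ _ => sq_nonneg _)
          (Finset.mem_univ j)
      have h2 : (1 : ℝ) ≤ 4 * Real.pi ^ 2 := by nlinarith [Real.pi_gt_three]
      unfold laplaceEigenvalue
      nlinarith [sq_nonneg (k j : ℝ)]
    have hpos : 0 < 1 + laplaceEigenvalue k := by linarith [laplaceEigenvalue_nonneg k]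
    have hj : ∀ j : Fin 3, (1 + laplaceEigenvalue k) ^ (-(2 / 3) : ℝ) ≤
        (1 + (k j : ℝ) ^ 2) ^ (-(2 / 3) : ℝ) := fun j =>
      Real.rpow_le_rpow_of_nonpos (by positivity) (hb j) (by norm_num)
    have e : (1 + laplaceEigenvalue k)⁻¹ ^ 2 = (1 + laplaceEigenvalue k) ^ (-(2 / 3) : ℝ) *
        ((1 + laplaceEigenvalue k) ^ (-(2 / 3) : ℝ) *
          (1 + laplaceEigenvalue k) ^ (-(2 / 3) : ℝ)) := by
      rw [← Real.rpow_add hpos, ← Real.rpow_add hpos, ← Real.rpow_neg_one, ← Real.rpow_natCast,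
        ← Real.rpow_mul hpos.le]
      norm_num
    rw [weight, ← ENNReal.ofReal_inv_of_pos hpos, ← ENNReal.ofReal_pow (by positivity), hg,
      ← ENNReal.ofReal_mul (by positivity), ← ENNReal.ofReal_mul (by positivity)]
    apply ENNReal.ofReal_le_ofReal
    rw [e]
    exact mul_le_mul (hj 0) (mul_le_mul (hj 1) (hj 2) (by positivity) (by positivity))
      (by positivity) (by positivity)
  have hprod : ∑' k : Freq, g (k 0) * (g (k 1) * g (k 2)) ≤
      (∑' n, g n) * ((∑' n, g n) * ∑' n, g n) := by
    let φ : Freq → ℤ × ℤ × ℤ := fun k => (k 0, k 1, k 2)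
    have hφ : Function.Injective φ := by
      intro a b hab
      simp only [φ, Prod.mk.injEq] at hab
      ext j
      fin_cases j <;> simp [hab]
    refine (ENNReal.tsum_comp_le_tsum_of_injective hφ
      (fun p : ℤ × ℤ × ℤ => g p.1 * (g p.2.1 * g p.2.2))).trans (le_of_eq ?_)
    simp_rw [ENNReal.tsum_prod', ENNReal.tsum_mul_left, ENNReal.tsum_mul_right]
  refine ne_top_of_le_ne_top ?_ ((ENNReal.tsum_le_tsum fun k => ?_).trans hprod)
  · exact ENNReal.mul_ne_top hgsum (ENNReal.mul_ne_top hgsum hgsum)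
  · simpa using hle k

/-- There are symmetric finite sets of frequencies with small lattice tail. -/
lemma exists_latticeTail_le (S₀ : Finset Freq) {η : ℝ≥0∞} (hη : 0 < η) :
    ∃ S : Finset Freq, S₀ ⊆ S ∧ (∀ k ∈ S, -k ∈ S) ∧ latticeTail S ≤ η := by
  have h0 : ∑' k : Freq, (weight k)⁻¹ ^ 2 ≠ ⊤ := by
    simpa [latticeTail] using latticeTail_empty_ne_top
  have ht := ENNReal.tendsto_tsum_compl_atTop_zero h0
  obtain ⟨S₁, hS₁⟩ := (ht.eventually (ge_mem_nhds hη)).exists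
  classical
  have hS₁' : latticeTail S₁ ≤ η := by
    refine le_trans (le_of_eq ?_) hS₁
    refine Eq.trans ?_ (tsum_subtype {k | k ∉ S₁} (fun k => (weight k)⁻¹ ^ 2)).symm
    refine tsum_congr fun k => ?_
    by_cases hk : k ∈ S₁ <;> simp [hk]
  refine ⟨(S₀ ∪ S₁) ∪ (S₀ ∪ S₁).image (fun k => -k), ?_, ?_, ?_⟩
  · exact Finset.subset_union_left.trans Finset.subset_union_left
  · intro k hk
    simp only [Finset.mem_union, Finset.mem_image] at hk ⊢
    rcases hk with hk | ⟨l, hl, rfl⟩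
    · exact Or.inr ⟨k, hk, rfl⟩
    · exact Or.inl (by simpa using hl)
  · exact (latticeTail_anti
      (Finset.subset_union_right.trans Finset.subset_union_left)).trans hS₁'

/-! ### Fourier coefficients of square integrable fields -/

instance : IsProbabilityMeasure torusMeasure := by
  unfold torusMeasure
  infer_instance

/-- The exponential `exp(2πi k·x)`. -/
abbrev expMode (k : Freq) : C(Torus, ℂ) := UnitAddTorus.mFourier k

/-- The Fourier coefficient `ûᵢ(k)`. -/
def hat (u : L2Field) (i : Fin 3) (k : Freq) : ℂ :=
  UnitAddTorus.mFourierCoeff (fun x : Torus => ((u x i : ℝ) : ℂ)) k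

lemma fourierSq_eq (u : L2Field) (k : Freq) : fourierSq u k = ∑ i, ‖hat u i k‖ₑ ^ 2 := rfl

lemma hat_eq_integral (u : L2Field) (i : Fin 3) (k : Freq) :
    hat u i k = ∫ x, expMode (-k) x * ((u x i : ℝ) : ℂ) ∂torusMeasure := rfl

lemma memLp_component (u : L2Field) (i : Fin 3) : MemLp (fun x => u x i) 2 torusMeasure :=
  (EuclideanSpace.proj (𝕜 := ℝ) i : R3 →L[ℝ] ℝ).comp_memLp' (Lp.memLp u)

lemma memLp_component_complex (u : L2Field) (i : Fin 3) :
    MemLp (fun x => ((u x i : ℝ) : ℂ)) 2 torusMeasure := (memLp_component u i).ofReal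

lemma memLp_expMode_mul {g : Torus → ℂ} (hg : MemLp g 2 torusMeasure) (k : Freq) :
    MemLp (fun x => expMode k x * g x) 2 torusMeasure := by
  refine hg.of_le ((map_continuous (expMode k)).aestronglyMeasurable.mul hg.1) (ae_of_all _ ?_)
  intro x
  rw [norm_mul]
  have : ‖expMode k x‖ ≤ 1 := by
    simpa only [UnitAddTorus.mFourier_norm] using (expMode k).norm_coe_le_norm x
  exact mul_le_of_le_one_left (norm_nonneg _) this

lemma integrable_expMode_mul_component (u : L2Field) (i : Fin 3) (k : Freq) :
    Integrable (fun x => expMode k x * ((u x i : ℝ) : ℂ)) torusMeasure :=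
  (memLp_expMode_mul (memLp_component_complex u i) k).integrable (by norm_num)

lemma hat_neg (u : L2Field) (i : Fin 3) (k : Freq) :
    hat u i (-k) = starRingEnd ℂ (hat u i k) := by
  rw [hat_eq_integral, hat_eq_integral, ← integral_conj]
  simp only [map_mul, Complex.conj_ofReal, UnitAddTorus.mFourier_neg, Complex.conj_conj]

lemma hat_sub (u v : L2Field) (i : Fin 3) (k : Freq) : hat (u - v) i k = hat u i k - hat v i k := by
  rw [hat_eq_integral, hat_eq_integral, hat_eq_integral,
    ← integral_sub (integrable_expMode_mul_component u i _)
      (integrable_expMode_mul_component v i _)]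
  refine integral_congr_ae ?_
  filter_upwards [Lp.coeFn_sub u v] with x hx
  simp only [hx, Pi.sub_apply, PiLp.sub_apply, Complex.ofReal_sub, mul_sub]

/-- The Fourier mode `∫ fⱼ gᵢ exp(2πi k·x) dx` of a product. -/
def productMode (f g : L2Field) (j i : Fin 3) (k : Freq) : ℂ :=
  ∫ x, expMode k x * (((f x j : ℝ) : ℂ) * ((g x i : ℝ) : ℂ)) ∂torusMeasure

lemma integrable_productMode (f g : L2Field) (j i : Fin 3) (k : Freq) :
    Integrable (fun x => expMode k x * (((f x j : ℝ) : ℂ) * ((g x i : ℝ) : ℂ))) torusMeasure := by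
  have := (memLp_expMode_mul (memLp_component_complex f j) k).integrable_mul
    (memLp_component_complex g i)
  refine this.congr (ae_of_all _ fun x => ?_)
  simp [mul_assoc]

lemma productMode_sub_left (f f' g : L2Field) (j i : Fin 3) (k : Freq) :
    productMode (f - f') g j i k = productMode f g j i k - productMode f' g j i k := by
  unfold productMode
  rw [← integral_sub (integrable_productMode _ _ _ _ _) (integrable_productMode _ _ _ _ _)]
  refine integral_congr_ae ?_
  filter_upwards [Lp.coeFn_sub f f'] with x hx
  simp only [hx, Pi.sub_apply, PiLp.sub_apply, Complex.ofReal_sub]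
  ring

lemma productMode_sub_right (f g g' : L2Field) (j i : Fin 3) (k : Freq) :
    productMode f (g - g') j i k = productMode f g j i k - productMode f g' j i k := by
  unfold productMode
  rw [← integral_sub (integrable_productMode _ _ _ _ _) (integrable_productMode _ _ _ _ _)]
  refine integral_congr_ae ?_
  filter_upwards [Lp.coeFn_sub g g'] with x hx
  simp only [hx, Pi.sub_apply, PiLp.sub_apply, Complex.ofReal_sub]
  ring

lemma hasSum_conj_mFourierCoeff_mul {f g : Torus → ℂ} (hf : MemLp f 2 torusMeasure)
    (hg : MemLp g 2 torusMeasure) :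
    HasSum (fun k => starRingEnd ℂ (UnitAddTorus.mFourierCoeff f k) *
      UnitAddTorus.mFourierCoeff g k) (∫ x, starRingEnd ℂ (f x) * g x ∂torusMeasure) := by
  have h := UnitAddTorus.hasSum_prod_mFourierCoeff (d := Fin 3) (hf.toLp f) (hg.toLp g)
  have hc : ∀ {f : Torus → ℂ} (hf : MemLp f 2 torusMeasure) (k : Freq),
      UnitAddTorus.mFourierCoeff (hf.toLp f) k = UnitAddTorus.mFourierCoeff f k :=
    fun hf k => integral_congr_ae (hf.coeFn_toLp.mono fun x hx => by simp only [hx])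
  have hi : ∫ x, starRingEnd ℂ (hf.toLp f x) * hg.toLp g x ∂torusMeasure =
      ∫ x, starRingEnd ℂ (f x) * g x ∂torusMeasure := by
    refine integral_congr_ae ?_
    filter_upwards [hf.coeFn_toLp, hg.coeFn_toLp] with x hx hy
    rw [hx, hy]
  rw [← hi]
  refine HasSum.congr_fun h fun k => ?_
  exact (congrArg₂ (fun z w => starRingEnd ℂ z * w) (hc hf k) (hc hg k)).symm

/-- Parseval for exp(-2πi k·x)fⱼ, whose modes are translates of those of fⱼ, against gᵢ: the mode of
the product is a convolution. This needs only square integrable factors. -/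
lemma enorm_productMode_le (f g : L2Field) (j i : Fin 3) (k : Freq) :
    ‖productMode f g j i k‖ₑ ≤
      majorant (fun l => ‖hat f j l‖ₑ) (fun l => ‖hat g i l‖ₑ) k := by
  have h := hasSum_conj_mFourierCoeff_mul
    (memLp_expMode_mul (memLp_component_complex f j) (-k)) (memLp_component_complex g i)
  have e : ∀ l, UnitAddTorus.mFourierCoeff
      (fun x => expMode (-k) x * ((f x j : ℝ) : ℂ)) l = hat f j (k + l) := by
    intro l
    rw [hat_eq_integral]
    refine integral_congr_ae (ae_of_all _ fun x => ?_)
    simp only [smul_eq_mul]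
    rw [← mul_assoc, ← UnitAddTorus.mFourier_add, neg_add_rev]
  have e' : ∫ x, starRingEnd ℂ (expMode (-k) x * ((f x j : ℝ) : ℂ)) * ((g x i : ℝ) : ℂ)
      ∂torusMeasure = productMode f g j i k := by
    refine integral_congr_ae (ae_of_all _ fun x => ?_)
    simp only [map_mul, Complex.conj_ofReal, UnitAddTorus.mFourier_neg, Complex.conj_conj, mul_assoc]
  simp only [e, e'] at h
  rw [majorant_comm, ← h.tsum_eq]
  refine enorm_tsum_le_tsum_enorm.trans (ENNReal.tsum_le_tsum fun l => le_of_eq ?_)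
  rw [enorm_mul, mul_comm]
  congr 1
  have : -k - l = -(k + l) := by abel
  beta_reduce
  rw [this, hat_neg]

/-! ### Real trigonometric polynomials -/

/-- The real part of `∑_{k ∈ S} aₖ exp(2πi k·x)`. -/
def trigPoly (S : Finset Freq) (a : Freq → ℂ) (x : Torus) : ℝ :=
  (∑ k ∈ S, a k * expMode k x).re

/-- The symbol `2πi kⱼ` of the `j`-th partial derivative. -/
def derivCoeff (j : Fin 3) (k : Freq) : ℂ := 2 * Real.pi * Complex.I * k j

/-- The vector field with components `trigPoly S (aᵢ)`. -/
def trigField (S : Finset Freq) (a : Freq → Fin 3 → ℂ) (x : Torus) : R3 :=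
  WithLp.toLp 2 fun i => trigPoly S (fun k => a k i) x

@[simp] lemma trigField_apply (S : Finset Freq) (a : Freq → Fin 3 → ℂ) (x : Torus) (i : Fin 3) :
    trigField S a x i = trigPoly S (fun k => a k i) x := rfl

lemma expMode_coe (k : Freq) (y : Fin 3 → ℝ) :
    expMode k (fun i => (y i : UnitAddCircle)) =
      ∏ i, Complex.exp (2 * Real.pi * Complex.I * k i * y i) := by
  simp only [expMode, UnitAddTorus.mFourier, ContinuousMap.coe_mk]
  refine Finset.prod_congr rfl fun i _ => ?_
  rw [fourier_coe_apply]
  simp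

lemma expMode_add_single (k : Freq) (x : Torus) (j : Fin 3) (h : ℝ) :
    expMode k (x + Pi.single j (h : UnitAddCircle)) =
      expMode k x * Complex.exp (derivCoeff j k * h) := by
  simp only [expMode, UnitAddTorus.mFourier, ContinuousMap.coe_mk]
  rw [← Finset.mul_prod_erase _ _ (Finset.mem_univ j),
    ← Finset.mul_prod_erase _ (fun i => fourier (k i) (x i)) (Finset.mem_univ j)]
  have h1 : fourier (k j) ((x + Pi.single j (h : UnitAddCircle) : Torus) j) =
      fourier (k j) (x j) * Complex.exp (derivCoeff j k * h) := by
    rw [Pi.add_apply, Pi.single_eq_same, fourier_apply, smul_add, AddCircle.toCircle_add,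
      Circle.coe_mul, fourier_apply, ← fourier_apply (n := k j) (x := (h : UnitAddCircle)),
      fourier_coe_apply]
    simp [derivCoeff]
  have h2 : ∀ i ∈ Finset.univ.erase j, fourier (k i) ((x + Pi.single j (h : UnitAddCircle) : Torus) i) =
      fourier (k i) (x i) := by
    intro i hi
    rw [Pi.add_apply, Pi.single_eq_of_ne (Finset.ne_of_mem_erase hi), add_zero]
  rw [h1, Finset.prod_congr rfl h2]
  ring

lemma hasDerivAt_trigPoly (S : Finset Freq) (a : Freq → ℂ) (j : Fin 3) (x : Torus) :
    HasDerivAt (fun h : ℝ => trigPoly S a (x + Pi.single j (h : UnitAddCircle)))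
      (trigPoly S (fun k => derivCoeff j k * a k) x) 0 := by
  have hk : ∀ k ∈ S, HasDerivAt
      (fun h : ℝ => a k * expMode k (x + Pi.single j (h : UnitAddCircle)))
      (derivCoeff j k * a k * expMode k x) 0 := by
    intro k _
    simp only [expMode_add_single]
    have h1 : HasDerivAt (fun h : ℝ => derivCoeff j k * (h : ℂ)) (derivCoeff j k) 0 := by
      simpa using (Complex.ofRealCLM.hasDerivAt (x := (0 : ℝ))).const_mul (derivCoeff j k)
    have h2 := ((h1.cexp).const_mul (expMode k x)).const_mul (a k)
    convert! h2 using 1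
    simp
    ring
  have h3 := HasDerivAt.fun_sum hk
  exact Complex.reCLM.hasFDerivAt.comp_hasDerivAt 0 h3

lemma partialDeriv_trigPoly (S : Finset Freq) (a : Freq → ℂ) (j : Fin 3) (x : Torus) :
    partialDeriv j (trigPoly S a) x = trigPoly S (fun k => derivCoeff j k * a k) x :=
  (hasDerivAt_trigPoly S a j x).deriv

lemma hasDerivAt_trigField (S : Finset Freq) (a : Freq → Fin 3 → ℂ) (j : Fin 3) (x : Torus) :
    HasDerivAt (fun h : ℝ => trigField S a (x + Pi.single j (h : UnitAddCircle)))
      (trigField S (fun k i => derivCoeff j k * a k i) x) 0 := by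
  have h := hasDerivAt_pi.2 fun i => hasDerivAt_trigPoly S (fun k => a k i) j x
  exact (PiLp.continuousLinearEquiv 2 ℝ (fun _ : Fin 3 => ℝ)).symm.hasFDerivAt.comp_hasDerivAt 0 h

lemma partialDeriv_trigField (S : Finset Freq) (a : Freq → Fin 3 → ℂ) (j : Fin 3) :
    partialDeriv j (trigField S a) = trigField S (fun k i => derivCoeff j k * a k i) := by
  funext x
  exact (hasDerivAt_trigField S a j x).deriv

lemma sum_derivCoeff_sq (k : Freq) : ∑ j, derivCoeff j k * derivCoeff j k =
    ((-laplaceEigenvalue k : ℝ) : ℂ) := by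
  simp only [derivCoeff, laplaceEigenvalue]
  push_cast
  rw [Finset.mul_sum, ← Finset.sum_neg_distrib]
  refine Finset.sum_congr rfl fun j _ => ?_
  linear_combination (4 * (Real.pi : ℂ) ^ 2 * (k j : ℂ) ^ 2) * Complex.I_sq

lemma laplacian_trigField (S : Finset Freq) (a : Freq → Fin 3 → ℂ) (x : Torus) :
    laplacian (trigField S a) x =
      trigField S (fun k i => ((-laplaceEigenvalue k : ℝ) : ℂ) * a k i) x := by
  unfold laplacian
  simp only [partialDeriv_trigField]
  ext i
  simp only [WithLp.ofLp_sum, Finset.sum_apply, trigField_apply, trigPoly, ← Complex.re_sum]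
  rw [Finset.sum_comm]
  congr 1
  refine Finset.sum_congr rfl fun k _ => ?_
  rw [← sum_derivCoeff_sq, Finset.sum_mul, Finset.sum_mul]
  exact Finset.sum_congr rfl fun j _ => by ring

lemma isSmooth_trigPoly (S : Finset Freq) (a : Freq → ℂ) : IsSmooth (trigPoly S a) := by
  unfold IsSmooth trigPoly
  simp only [expMode_coe]
  refine Complex.reCLM.contDiff.comp (ContDiff.sum fun k _ => contDiff_const.mul
    (contDiff_prod fun i _ => ContDiff.cexp (contDiff_const.mul
      (Complex.ofRealCLM.contDiff.comp (contDiff_apply ℝ ℝ i)))))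

lemma isSmooth_trigField (S : Finset Freq) (a : Freq → Fin 3 → ℂ) : IsSmooth (trigField S a) :=
  contDiff_euclidean.2 fun i => isSmooth_trigPoly S fun k => a k i

lemma continuous_trigPoly (S : Finset Freq) (a : Freq → ℂ) : Continuous (trigPoly S a) := by
  unfold trigPoly
  fun_prop

lemma continuous_trigField (S : Finset Freq) (a : Freq → Fin 3 → ℂ) :
    Continuous (trigField S a) :=
  (PiLp.continuous_toLp 2 _).comp (continuous_pi fun i => continuous_trigPoly S fun k => a k i)

lemma isTestField_trigField {S : Finset Freq} {a : Freq → Fin 3 → ℂ}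
    (ha : ∀ k ∈ S, ∑ j, (k j : ℂ) * a k j = 0) : IsTestField (trigField S a) where
  smooth := isSmooth_trigField S a
  divFree x := by
    simp only [partialDeriv_trigField, trigField_apply, trigPoly, ← Complex.re_sum]
    rw [Finset.sum_comm, Finset.sum_eq_zero, Complex.zero_re]
    intro k hk
    have : ∑ j, derivCoeff j k * a k j * expMode k x =
        2 * Real.pi * Complex.I * (∑ j, (k j : ℂ) * a k j) * expMode k x := by
      simp only [Finset.mul_sum, Finset.sum_mul, derivCoeff]
      exact Finset.sum_congr rfl fun j _ => by ring
    rw [this, ha k hk]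
    simp

/-! ### Pairings with trigonometric fields -/

lemma inner_R3 (x y : R3) : inner ℝ x y = ∑ i, x i * y i := by
  simp [PiLp.inner_apply, mul_comm]

lemma integral_component_mul_expMode (u : L2Field) (i : Fin 3) (k : Freq) :
    ∫ x, expMode k x * ((u x i : ℝ) : ℂ) ∂torusMeasure = starRingEnd ℂ (hat u i k) := by
  rw [← hat_neg, hat_eq_integral, neg_neg]

lemma integrable_component_mul (u : L2Field) (i : Fin 3) {g : Torus → ℝ} (hg : Continuous g) :
    Integrable (fun x => u x i * g x) torusMeasure := by
  have h : MemLp g 2 torusMeasure :=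
    hg.memLp_of_hasCompactSupport (HasCompactSupport.of_compactSpace g)
  exact (memLp_component u i).integrable_mul h

lemma integral_component_mul_trigPoly (u : L2Field) (i : Fin 3) (S : Finset Freq) (a : Freq → ℂ) :
    ∫ x, u x i * trigPoly S a x ∂torusMeasure =
      (∑ k ∈ S, a k * starRingEnd ℂ (hat u i k)).re := by
  have e : ∀ x, u x i * trigPoly S a x =
      RCLike.re (∑ k ∈ S, a k * (expMode k x * ((u x i : ℝ) : ℂ))) := by
    intro x
    rw [RCLike.re_eq_complex_re, trigPoly, ← Complex.re_ofReal_mul, Finset.mul_sum]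
    congr 1
    exact Finset.sum_congr rfl fun k _ => by ring
  simp only [e]
  rw [integral_re, integral_finsetSum, RCLike.re_eq_complex_re]
  · simp only [integral_const_mul, integral_component_mul_expMode]
  · exact fun k _ => (integrable_expMode_mul_component u i k).const_mul _
  · exact integrable_finsetSum _ fun k _ => (integrable_expMode_mul_component u i k).const_mul _

lemma integral_inner_trigField (u : L2Field) (S : Finset Freq) (a : Freq → Fin 3 → ℂ) :
    ∫ x, inner ℝ (u x) (trigField S a x) ∂torusMeasure =
      (∑ k ∈ S, ∑ i, a k i * starRingEnd ℂ (hat u i k)).re := by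
  simp only [inner_R3, trigField_apply]
  rw [integral_finsetSum _ fun i _ => integrable_component_mul u i (continuous_trigPoly S _)]
  simp only [integral_component_mul_trigPoly, ← Complex.re_sum]
  rw [Finset.sum_comm]

/-- Divergence-free fields have Fourier coefficients orthogonal to the frequency. -/
lemma IsDivFree.sum_mul_hat {u : L2Field} (hu : IsDivFree u) (k : Freq) :
    ∑ j, (k j : ℂ) * hat u j k = 0 := by
  have h : ∀ c : ℂ, (c * starRingEnd ℂ (∑ j, (k j : ℂ) * hat u j k)).re = 0 := by
    intro c
    -- Dividing by 2πi cancels the factor produced by differentiation. The free constant c is later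
    -- set equal to k·û(k), which makes the real part a squared modulus.
    have h1 := hu (trigPoly {k} fun _ => c / (2 * Real.pi * Complex.I)) (isSmooth_trigPoly _ _)
    simp only [partialDeriv_trigPoly] at h1
    rw [integral_finsetSum _ fun i _ => integrable_component_mul u i (continuous_trigPoly _ _)] at h1
    simp only [integral_component_mul_trigPoly, Finset.sum_singleton, ← Complex.re_sum] at h1
    rw [← h1, map_sum, Finset.mul_sum]
    congr 1
    refine Finset.sum_congr rfl fun j _ => ?_
    rw [derivCoeff, map_mul, map_intCast]
    field_simp [Real.pi_ne_zero, Complex.I_ne_zero]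
  have h2 := h (∑ j, (k j : ℂ) * hat u j k)
  rw [Complex.mul_conj, Complex.ofReal_re, Complex.normSq_eq_zero] at h2
  exact h2

/-! ### The trilinear transport term and truncation to finitely many frequencies. -/

/-- The transport term `∫ g · (f · ∇)φ` for the trigonometric field `φ` with coefficients `a`. -/
def transport (f g : L2Field) (S : Finset Freq) (a : Freq → Fin 3 → ℂ) : ℝ :=
  ∫ x, ∑ j : Fin 3, f x j * inner ℝ (g x) (partialDeriv j (trigField S a) x) ∂torusMeasure

/-- The test field has finitely many modes, so the term is a finite combination of modes of the
products fⱼgᵢ. Linearity in f and g and all estimates are read off from this form. -/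
lemma transport_eq (f g : L2Field) (S : Finset Freq) (a : Freq → Fin 3 → ℂ) :
    transport f g S a =
      (∑ k ∈ S, ∑ j, ∑ i, derivCoeff j k * a k i * productMode f g j i k).re := by
  have e : ∀ x, ∑ j : Fin 3, f x j * inner ℝ (g x) (partialDeriv j (trigField S a) x) =
      RCLike.re (∑ k ∈ S, ∑ j, ∑ i, derivCoeff j k * a k i *
        (expMode k x * (((f x j : ℝ) : ℂ) * ((g x i : ℝ) : ℂ)))) := by
    intro x
    simp only [partialDeriv_trigField, inner_R3, trigField_apply, trigPoly]
    rw [Finset.sum_comm, map_sum]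
    refine Finset.sum_congr rfl fun j _ => ?_
    rw [Finset.sum_comm, Finset.mul_sum, map_sum]
    refine Finset.sum_congr rfl fun i _ => ?_
    rw [RCLike.re_eq_complex_re, ← mul_assoc, ← Complex.re_ofReal_mul, Finset.mul_sum]
    congr 1
    refine Finset.sum_congr rfl fun k _ => ?_
    push_cast
    ring
  have hint : ∀ k ∈ S, ∀ j ∈ (Finset.univ : Finset (Fin 3)), ∀ i ∈ (Finset.univ : Finset (Fin 3)),
      Integrable (fun x => derivCoeff j k * a k i *
        (expMode k x * (((f x j : ℝ) : ℂ) * ((g x i : ℝ) : ℂ)))) torusMeasure :=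
    fun k _ j _ i _ => (integrable_productMode f g j i k).const_mul _
  unfold transport
  simp only [e]
  rw [integral_re (integrable_finsetSum _ fun k hk => integrable_finsetSum _ fun j hj =>
      integrable_finsetSum _ (hint k hk j hj)),
    integral_finsetSum _ fun k hk => integrable_finsetSum _ fun j hj =>
      integrable_finsetSum _ (hint k hk j hj), RCLike.re_eq_complex_re]
  congr 1
  refine Finset.sum_congr rfl fun k hk => ?_
  rw [integral_finsetSum _ fun j hj => integrable_finsetSum _ (hint k hk j hj)]
  refine Finset.sum_congr rfl fun j hj => ?_
  rw [integral_finsetSum _ (hint k hk j hj)]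
  exact Finset.sum_congr rfl fun i _ => integral_const_mul _ _

lemma transport_sub_left (f f' g : L2Field) (S : Finset Freq) (a : Freq → Fin 3 → ℂ) :
    transport (f - f') g S a = transport f g S a - transport f' g S a := by
  simp only [transport_eq, productMode_sub_left, mul_sub, Finset.sum_sub_distrib, Complex.sub_re]

lemma transport_sub_right (f g g' : L2Field) (S : Finset Freq) (a : Freq → Fin 3 → ℂ) :
    transport f (g - g') S a = transport f g S a - transport f g' S a := by
  simp only [transport_eq, productMode_sub_right, mul_sub, Finset.sum_sub_distrib, Complex.sub_re]

/-- The square integrable class of a trigonometric field. -/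
def trigLp (S : Finset Freq) (a : Freq → Fin 3 → ℂ) : L2Field :=
  ((continuous_trigField S a).memLp_of_hasCompactSupport
    (HasCompactSupport.of_compactSpace _)).toLp (trigField S a)

lemma coeFn_trigLp (S : Finset Freq) (a : Freq → Fin 3 → ℂ) :
    trigLp S a =ᵐ[torusMeasure] trigField S a := MemLp.coeFn_toLp _

/-- Transport by a divergence-free field is antisymmetric on trigonometric fields. -/
lemma transport_trigLp_antisymm {f : L2Field} (hf : IsDivFree f) (S : Finset Freq)
    (a b : Freq → Fin 3 → ℂ) :
    transport f (trigLp S a) S b = -transport f (trigLp S b) S a := by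
  -- The divergence condition on f is tested with the scalar product of the two fields, whose
  -- gradient splits by the product rule.
  have hψ : ∀ j x, partialDeriv j
      (fun x => ∑ i, trigPoly S (fun k => a k i) x * trigPoly S (fun k => b k i) x) x =
      inner ℝ (trigField S a x) (partialDeriv j (trigField S b) x) +
        inner ℝ (trigField S b x) (partialDeriv j (trigField S a) x) := by
    intro j x
    have h := HasDerivAt.fun_sum (u := (Finset.univ : Finset (Fin 3))) fun i _ =>
      (hasDerivAt_trigPoly S (fun k => a k i) j x).fun_mul
        (hasDerivAt_trigPoly S (fun k => b k i) j x)
    refine h.deriv.trans ?_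
    simp only [partialDeriv_trigField, inner_R3, trigField_apply, QuotientAddGroup.mk_zero,
      Pi.single_zero, add_zero, ← Finset.sum_add_distrib]
    exact Finset.sum_congr rfl fun i _ => by ring
  have hsm : IsSmooth
      (fun x => ∑ i, trigPoly S (fun k => a k i) x * trigPoly S (fun k => b k i) x) :=
    ContDiff.sum fun i _ => (isSmooth_trigPoly S fun k => a k i).mul
      (isSmooth_trigPoly S fun k => b k i)
  have h0 := hf _ hsm
  simp only [hψ, mul_add, Finset.sum_add_distrib] at h0
  have hcont : ∀ (a b : Freq → Fin 3 → ℂ) (j : Fin 3),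
      Continuous fun x => inner ℝ (trigField S a x) (partialDeriv j (trigField S b) x) := by
    intro a b j
    rw [partialDeriv_trigField]
    exact (continuous_trigField S a).inner (continuous_trigField S _)
  have hint : ∀ a b : Freq → Fin 3 → ℂ, Integrable (fun x => ∑ j, f x j *
      inner ℝ (trigField S a x) (partialDeriv j (trigField S b) x)) torusMeasure :=
    fun a b => integrable_finsetSum _ fun j _ => integrable_component_mul f j (hcont a b j)
  have hae : ∀ a b : Freq → Fin 3 → ℂ, transport f (trigLp S a) S b = ∫ x, ∑ j, f x j *
      inner ℝ (trigField S a x) (partialDeriv j (trigField S b) x) ∂torusMeasure := by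
    intro a b
    refine integral_congr_ae ?_
    filter_upwards [coeFn_trigLp S a] with x hx
    rw [hx]
  rw [integral_add (hint a b) (hint b a), ← hae, ← hae] at h0
  linarith

lemma integral_expMode (k : Freq) : ∫ x, expMode k x ∂torusMeasure = if k = 0 then 1 else 0 := by
  have h := orthonormal_iff_ite.1 (UnitAddTorus.orthonormal_mFourier (d := Fin 3)) 0 k
  rw [ContinuousMap.inner_toLp] at h
  simp only [UnitAddTorus.mFourier_zero, ContinuousMap.one_apply, map_one, mul_one, eq_comm (a := (0 : Freq))] at h
  exact h

/-- The truncation of a field to the frequencies in `S`. -/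
def proj (S : Finset Freq) (u : L2Field) : L2Field := trigLp S fun k i => hat u i k

/-- Symmetry of S makes ∑ û(k)exp(2πi k·x) over S real, so the real part taken in `trigPoly` changes
nothing. -/
lemma hat_proj {S : Finset Freq} (hS : ∀ k ∈ S, -k ∈ S) (u : L2Field) (i : Fin 3) (k : Freq) :
    hat (proj S u) i k = if k ∈ S then hat u i k else 0 := by
  have hreal : ∀ x, ((trigPoly S (fun k => hat u i k) x : ℝ) : ℂ) =
      ∑ l ∈ S, hat u i l * expMode l x := by
    intro x
    rw [trigPoly, ← Complex.conj_eq_iff_re, map_sum]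
    refine Finset.sum_nbij' (fun l => -l) (fun l => -l) hS hS (by simp) (by simp) fun l _ => ?_
    rw [hat_neg, UnitAddTorus.mFourier_neg, map_mul]
  have e : hat (proj S u) i k = ∫ x, ∑ l ∈ S, hat u i l * expMode (-k + l) x ∂torusMeasure := by
    rw [hat_eq_integral]
    refine integral_congr_ae ?_
    filter_upwards [coeFn_trigLp S fun k i => hat u i k] with x hx
    rw [proj, hx, trigField_apply, hreal, Finset.mul_sum]
    refine Finset.sum_congr rfl fun l _ => ?_
    rw [UnitAddTorus.mFourier_add]
    ring
  rw [e, integral_finsetSum]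
  · simp only [integral_const_mul, integral_expMode, neg_add_eq_zero, mul_ite, mul_one, mul_zero]
    rw [Finset.sum_ite_eq]
  · intro l _
    exact ((map_continuous (expMode (-k + l))).integrable_of_hasCompactSupport
      (HasCompactSupport.of_compactSpace _)).const_mul _

/-! ### Sobolev estimates for the transport term -/

/-- The square of the norm of `Hᵐ`. -/
def sobolevSq (m : ℕ) (u : L2Field) : ℝ≥0∞ := ∑' k, weight k ^ m * fourierSq u k

lemma sobolevNorm_sq (m : ℕ) (u : L2Field) : sobolevNorm m u ^ 2 = sobolevSq m u := by
  rw [sobolevNorm, ← ENNReal.rpow_two, ← ENNReal.rpow_mul]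
  norm_num
  refine tsum_congr fun k => ?_
  rw [weight, ENNReal.ofReal_pow (by linarith [laplaceEigenvalue_nonneg k])]

lemma sobolevSq_mono {m n : ℕ} (h : m ≤ n) (u : L2Field) : sobolevSq m u ≤ sobolevSq n u :=
  ENNReal.tsum_le_tsum fun k => mul_le_mul_left (pow_le_pow_right₀ (one_le_weight k) h) _

lemma fourierSq_le {u v : L2Field} {k : Freq} (h : ∀ i, ‖hat u i k‖ₑ ≤ ‖hat v i k‖ₑ) :
    fourierSq u k ≤ fourierSq v k := by
  simp only [fourierSq_eq]
  exact Finset.sum_le_sum fun i _ => pow_le_pow_left' (h i) 2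

lemma sobolevSq_le {u v : L2Field} (h : ∀ i k, ‖hat u i k‖ₑ ≤ ‖hat v i k‖ₑ) (m : ℕ) :
    sobolevSq m u ≤ sobolevSq m v :=
  ENNReal.tsum_le_tsum fun k => mul_le_mul_right (fourierSq_le fun i => h i k) _

lemma sum_three_sq_le (x : Fin 3 → ℝ≥0∞) : (∑ i, x i) ^ 2 ≤ 3 * ∑ i, x i ^ 2 := by
  have h := tsum_sq_le_of_sq_le (f := x) (a := fun _ => 1) (b := fun i => x i ^ 2)
    fun i => (one_mul _).ge
  simpa [tsum_fintype] using h

/-- `∑ᵢ |ûᵢ(k)|`. -/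
def hatSum (u : L2Field) (k : Freq) : ℝ≥0∞ := ∑ i, ‖hat u i k‖ₑ

lemma hatSum_sq_le (u : L2Field) (k : Freq) : hatSum u k ^ 2 ≤ 3 * fourierSq u k :=
  sum_three_sq_le _

lemma tsum_weight_mul_hatSum_sq_le (m : ℕ) (u : L2Field) :
    ∑' k, weight k ^ m * hatSum u k ^ 2 ≤ 3 * sobolevSq m u := by
  rw [sobolevSq, ← ENNReal.tsum_mul_left]
  refine ENNReal.tsum_le_tsum fun k => ?_
  rw [mul_left_comm]
  exact mul_le_mul_right (hatSum_sq_le u k) _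

/-- `∑ⱼ 2π|kⱼ|`. -/
def derivSum (k : Freq) : ℝ≥0∞ := ∑ j, ‖derivCoeff j k‖ₑ

lemma derivSum_sq_le (k : Freq) : derivSum k ^ 2 ≤ 3 * ENNReal.ofReal (laplaceEigenvalue k) := by
  refine (sum_three_sq_le _).trans (le_of_eq ?_)
  congr 1
  rw [laplaceEigenvalue, Finset.mul_sum, ENNReal.ofReal_sum_of_nonneg fun j _ => by positivity]
  refine Finset.sum_congr rfl fun j _ => ?_
  rw [← ofReal_norm, ← ENNReal.ofReal_pow (norm_nonneg _)]
  congr 1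
  rw [derivCoeff]
  simp only [norm_mul, Complex.norm_ofNat, Complex.norm_real, Complex.norm_I, Complex.norm_intCast,
    Real.norm_eq_abs, mul_one, mul_pow, sq_abs]
  norm_num

/-- Cancellation and vector structure are discarded: components are summed, leaving a scalar
trilinear sum with the derivative on the test modes. -/
lemma enorm_transport_le (f g : L2Field) (S : Finset Freq) (a : Freq → Fin 3 → ℂ) :
    ‖transport f g S a‖ₑ ≤ ∑' k, (if k ∈ S then derivSum k * ∑ i, ‖a k i‖ₑ else 0) *
      majorant (hatSum f) (hatSum g) k := by
  have hsupp : ∀ k ∉ S, (if k ∈ S then derivSum k * ∑ i, ‖a k i‖ₑ else 0) *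
      majorant (hatSum f) (hatSum g) k = 0 := fun k hk => by simp [hk]
  have hmaj : ∀ j i k, ‖productMode f g j i k‖ₑ ≤ majorant (hatSum f) (hatSum g) k := by
    intro j i k
    refine (enorm_productMode_le f g j i k).trans (ENNReal.tsum_le_tsum fun l => ?_)
    exact mul_le_mul'
      (Finset.single_le_sum (f := fun j => ‖hat f j l‖ₑ) (fun _ _ => zero_le) (Finset.mem_univ j))
      (Finset.single_le_sum (f := fun i => ‖hat g i (-k - l)‖ₑ) (fun _ _ => zero_le)
        (Finset.mem_univ i))
  have hre : ∀ z : ℂ, ‖z.re‖ₑ ≤ ‖z‖ₑ := fun z => by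
    rw [← ofReal_norm, ← ofReal_norm]
    exact ENNReal.ofReal_le_ofReal (Complex.abs_re_le_norm z)
  rw [tsum_eq_sum hsupp, transport_eq]
  refine (hre _).trans ((enorm_sum_le _ _).trans (Finset.sum_le_sum fun k hk => ?_))
  rw [if_pos hk, derivSum, Finset.sum_mul, Finset.sum_mul]
  refine (enorm_sum_le _ _).trans (Finset.sum_le_sum fun j _ => ?_)
  rw [Finset.mul_sum, Finset.sum_mul]
  refine (enorm_sum_le _ _).trans (Finset.sum_le_sum fun i _ => ?_)
  rw [enorm_mul, enorm_mul]
  exact mul_le_mul_right (hmaj j i k) _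

lemma derivSum_mul_hatSum_sq_le (h : L2Field) (k : Freq) :
    (derivSum k * hatSum h k) ^ 2 ≤ 9 * (ENNReal.ofReal (laplaceEigenvalue k) * fourierSq h k) := by
  rw [mul_pow]
  refine (mul_le_mul' (derivSum_sq_le k) (hatSum_sq_le h k)).trans (le_of_eq ?_)
  ring

lemma tsum_derivSum_sq_le (S : Finset Freq) (h : L2Field) :
    ∑' k, (if k ∈ S then derivSum k * hatSum h k else 0) ^ 2 ≤
      9 * ∑ k ∈ S, ENNReal.ofReal (laplaceEigenvalue k) * fourierSq h k := by
  rw [tsum_eq_sum (s := S) fun k hk => by simp [hk], Finset.mul_sum]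
  refine Finset.sum_le_sum fun k hk => ?_
  rw [if_pos hk]
  exact derivSum_mul_hatSum_sq_le h k

lemma sum_laplaceEigenvalue_mul_le (S : Finset Freq) (h : L2Field) :
    ∑ k ∈ S, ENNReal.ofReal (laplaceEigenvalue k) * fourierSq h k ≤ sobolevSq 1 h := by
  refine le_trans (Finset.sum_le_sum fun k _ => ?_)
    (ENNReal.sum_le_tsum (f := fun k => weight k ^ 1 * fourierSq h k) S)
  rw [pow_one]
  exact mul_le_mul_left (ofReal_laplaceEigenvalue_le_weight k) _

/-- The transport term is small when the modes of the transported field in `S` vanish. -/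
lemma enorm_transport_sq_le_of_hat_eq_zero {S : Finset Freq} {f g : L2Field} (h : L2Field)
    (hg : ∀ l ∈ S, ∀ i, hat g i l = 0) {c : ℝ≥0∞} (hc : latticeTail ∅ * latticeTail S ≤ c ^ 2) :
    ‖transport f g S (fun k i => hat h i k)‖ₑ ^ 2 ≤
      c * (81 * (sobolevSq 1 h * sobolevSq 1 f * sobolevSq 1 g)) := by
  have hG : ∀ l ∈ S, hatSum g l = 0 := fun l hl => by simp [hatSum, hg l hl]
  have hw : ∀ u, ∑' l, weight l * hatSum u l ^ 2 ≤ 3 * sobolevSq 1 u := fun u => by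
    simpa using tsum_weight_mul_hatSum_sq_le 1 u
  calc _ ≤ _ := pow_le_pow_left' (enorm_transport_le f g S _) 2
    _ ≤ _ := tsum_mul_majorant_sq_le hG hc
    _ ≤ c * (9 * sobolevSq 1 h) * (3 * sobolevSq 1 f) * (3 * sobolevSq 1 g) := by
        refine mul_le_mul' (mul_le_mul' (mul_le_mul_right ?_ _) (hw f)) (hw g)
        exact (tsum_derivSum_sq_le S h).trans
          (mul_le_mul_right (sum_laplaceEigenvalue_mul_le S h) _)
    _ = _ := by ring

/-- The transport term of an `L²` field against an `H³` field. -/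
lemma enorm_transport_le_of_sobolev_three (S : Finset Freq) (f h : L2Field) {Λ : ℝ≥0∞}
    (hΛ : latticeTail ∅ * (9 * sobolevSq 3 h) ≤ Λ ^ 2) :
    ‖transport f f S (fun k i => hat h i k)‖ₑ ≤ Λ * (3 * sobolevSq 0 f) := by
  have hmaj : ∀ k, majorant (hatSum f) (hatSum f) k ≤ 3 * sobolevSq 0 f := by
    intro k
    rw [← ENNReal.pow_le_pow_left_iff two_ne_zero, sq (3 * sobolevSq 0 f)]
    have h0 : ∑' l, hatSum f l ^ 2 ≤ 3 * sobolevSq 0 f := by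
      simpa using tsum_weight_mul_hatSum_sq_le 0 f
    exact (majorant_sq_le _ _ k).trans (mul_le_mul' h0 h0)
  -- The gradient series of h converges absolutely: |k||ĥ(k)| is split into the square summable
  -- inverse weight and an H³ factor.
  have hsum : ∑' k, (if k ∈ S then derivSum k * hatSum h k else 0) ≤ Λ := by
    rw [← ENNReal.pow_le_pow_left_iff two_ne_zero]
    refine le_trans (tsum_sq_le_of_sq_le (a := fun k => (weight k)⁻¹ ^ 2)
      (b := fun k => 9 * (weight k ^ 3 * fourierSq h k)) fun k => ?_) (le_trans (le_of_eq ?_) hΛ)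
    · split_ifs
      · refine (derivSum_mul_hatSum_sq_le h k).trans ?_
        have e : (weight k)⁻¹ ^ 2 * (9 * (weight k ^ 3 * fourierSq h k)) =
            ((weight k)⁻¹ * weight k) ^ 2 * (9 * (weight k * fourierSq h k)) := by ring
        rw [e, ENNReal.inv_mul_cancel (weight_ne_zero _) (weight_ne_top _), one_pow, one_mul]
        gcongr
        exact ofReal_laplaceEigenvalue_le_weight k
      · simp
    · rw [ENNReal.tsum_mul_left]
      simp [latticeTail, sobolevSq]
  refine (enorm_transport_le f f S _).trans ?_
  refine (ENNReal.tsum_le_tsum fun k => mul_le_mul_right (hmaj k) _).trans ?_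
  rw [ENNReal.tsum_mul_right]
  exact mul_le_mul_left hsum _

lemma weight_mul_majorant_le (F : Freq → ℝ≥0∞) (k : Freq) :
    weight k * majorant F F k ≤ 4 * majorant (fun l => weight l * F l) F k := by
  have h : weight k * majorant F F k ≤
      2 * majorant (fun l => weight l * F l) F k + 2 * majorant F (fun l => weight l * F l) k := by
    simp only [majorant, ← ENNReal.tsum_mul_left]
    rw [← ENNReal.tsum_add]
    refine ENNReal.tsum_le_tsum fun l => ?_
    refine (mul_le_mul_left (weight_sub_le k l) _).trans (le_of_eq ?_)
    ring
  refine h.trans (le_of_eq ?_)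
  rw [majorant_comm F, ← add_mul]
  norm_num

/-- The transport term of an `H³` field against the Laplacian of an `H¹` field. -/
lemma enorm_transport_laplacian_sq_le (S : Finset Freq) (v u : L2Field) :
    ‖transport v v S (fun k i => (laplaceEigenvalue k : ℂ) * hat u i k)‖ₑ ^ 2 ≤
      1296 * latticeTail ∅ * sobolevSq 3 v ^ 2 *
        ∑ k ∈ S, ENNReal.ofReal (laplaceEigenvalue k) * fourierSq u k := by
  -- The Laplacian factor is moved from u, which is only in H¹, to the convolution of v with itself
  -- by `weight_mul_majorant_le`; u keeps a single derivative.
  have h1 : ‖transport v v S (fun k i => (laplaceEigenvalue k : ℂ) * hat u i k)‖ₑ ≤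
      4 * ∑' k, (if k ∈ S then derivSum k * hatSum u k else 0) *
        majorant (fun l => weight l * hatSum v l) (hatSum v) k := by
    refine (enorm_transport_le v v S _).trans ?_
    rw [← ENNReal.tsum_mul_left]
    refine ENNReal.tsum_le_tsum fun k => ?_
    split_ifs with hk
    · have e : ∑ i, ‖(laplaceEigenvalue k : ℂ) * hat u i k‖ₑ ≤ weight k * hatSum u k := by
        rw [hatSum, Finset.mul_sum]
        refine Finset.sum_le_sum fun i _ => ?_
        rw [enorm_mul]
        refine mul_le_mul_left ?_ _
        rw [← ofReal_norm, Complex.norm_real, Real.norm_of_nonneg (laplaceEigenvalue_nonneg k)]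
        exact ofReal_laplaceEigenvalue_le_weight k
      calc _ ≤ derivSum k * (weight k * hatSum u k) * majorant (hatSum v) (hatSum v) k := by gcongr
        _ = derivSum k * hatSum u k * (weight k * majorant (hatSum v) (hatSum v) k) := by ring
        _ ≤ derivSum k * hatSum u k *
            (4 * majorant (fun l => weight l * hatSum v l) (hatSum v) k) := 
          mul_le_mul_right (weight_mul_majorant_le _ _) _
        _ = _ := by ring
    · simp
  have h2 := tsum_mul_majorant_sq_le (S := ∅)
    (d := fun k => if k ∈ S then derivSum k * hatSum u k else 0)
    (F := fun l => weight l * hatSum v l) (G := hatSum v) (by simp) (sq (latticeTail ∅)).ge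
  have h3 : ∑' l, weight l * (weight l * hatSum v l) ^ 2 ≤ 3 * sobolevSq 3 v := by
    refine le_trans (le_of_eq (tsum_congr fun l => ?_)) (tsum_weight_mul_hatSum_sq_le 3 v)
    ring
  have h4 : ∑' l, weight l * hatSum v l ^ 2 ≤ 3 * sobolevSq 3 v := by
    refine le_trans ?_ ((tsum_weight_mul_hatSum_sq_le 1 v).trans
      (mul_le_mul_right (sobolevSq_mono (by norm_num) v) _))
    simp
  calc _ ≤ _ := pow_le_pow_left' h1 2
    _ ≤ 4 ^ 2 * (latticeTail ∅ *
        (9 * ∑ k ∈ S, ENNReal.ofReal (laplaceEigenvalue k) * fourierSq u k) *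
        (3 * sobolevSq 3 v) * (3 * sobolevSq 3 v)) := by
      rw [mul_pow]
      refine mul_le_mul_right (h2.trans ?_) _
      exact mul_le_mul' (mul_le_mul' (mul_le_mul_right (tsum_derivSum_sq_le S u) _) h3) h4
    _ = _ := by ring

/-- For k outside S the single term (weight k)⁻² is at most the whole tail, hence (weight k)⁻¹ ≤ c
and the high modes gain a factor c from H¹. -/
lemma sobolevSq_zero_le {S : Finset Freq} {c : ℝ≥0∞} (hc : latticeTail S ≤ c ^ 2) (f : L2Field) :
    sobolevSq 0 f ≤ (∑ k ∈ S, fourierSq f k) + c * sobolevSq 1 f := by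
  have hinv : ∀ k ∉ S, (weight k)⁻¹ ≤ c := by
    intro k hk
    rw [← ENNReal.pow_le_pow_left_iff two_ne_zero]
    refine le_trans ?_ hc
    refine le_trans (le_of_eq ?_) (ENNReal.le_tsum k)
    rw [if_neg hk]
  have h1 : ∀ k, weight k ^ 0 * fourierSq f k ≤
      (if k ∈ S then fourierSq f k else 0) + c * (weight k ^ 1 * fourierSq f k) := by
    intro k
    rw [pow_zero, one_mul, pow_one]
    split_ifs with hk
    · exact le_self_add
    · rw [zero_add, ← mul_assoc]
      refine le_trans (le_of_eq ?_) (mul_le_mul_left (mul_le_mul_left (hinv k hk) _) _)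
      rw [ENNReal.inv_mul_cancel (weight_ne_zero _) (weight_ne_top _), one_mul]
  refine (ENNReal.tsum_le_tsum h1).trans (le_of_eq ?_)
  rw [ENNReal.tsum_add, ENNReal.tsum_mul_left, tsum_eq_sum (s := S) fun k hk => by simp [hk]]
  congr 1
  exact Finset.sum_congr rfl fun k hk => by simp [hk]

/-! ### Evolution of the Fourier modes -/

/-- The component of `eᵢ` orthogonal to `k`. -/
def lerayVec (k : Freq) (i l : Fin 3) : ℂ :=
  (if i = l then 1 else 0) - (k i : ℂ) * k l / ∑ j, (k j : ℂ) ^ 2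

lemma sum_freq_sq_ne_zero {k : Freq} (hk : k ≠ 0) : ∑ j, (k j : ℂ) ^ 2 ≠ 0 := by
  have h : ∑ j, (k j) ^ 2 ≠ 0 := by
    contrapose! hk
    rw [Finset.sum_eq_zero_iff_of_nonneg fun _ _ => sq_nonneg _] at hk
    ext j
    simpa using hk j (Finset.mem_univ j)
  exact_mod_cast h

/-- At k = 0 the quotient in `lerayVec` is 0/0 = 0, so the projection is the identity there, as it
should be for constant fields. -/
lemma sum_mul_lerayVec (k : Freq) (i : Fin 3) : ∑ l, (k l : ℂ) * lerayVec k i l = 0 := by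
  by_cases hk : k = 0
  · simp [hk]
  have h := sum_freq_sq_ne_zero hk
  have e : ∑ l, (k l : ℂ) * lerayVec k i l =
      k i - k i * (∑ l, (k l : ℂ) ^ 2) / ∑ j, (k j : ℂ) ^ 2 := by
    simp only [lerayVec, mul_sub, Finset.sum_sub_distrib, mul_ite, mul_one, mul_zero,
      Finset.sum_ite_eq, Finset.mem_univ, if_true]
    rw [Finset.mul_sum, Finset.sum_div]
    congr 1
    exact Finset.sum_congr rfl fun l _ => by ring
  rw [e, mul_div_assoc, div_self h, mul_one, sub_self]

lemma sum_mul_lerayVec_of_orthogonal {k : Freq} {c : Fin 3 → ℂ} (hc : ∑ i, (k i : ℂ) * c i = 0)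
    (l : Fin 3) : ∑ i, c i * lerayVec k i l = c l := by
  have e : ∑ i, c i * lerayVec k i l =
      c l - (∑ i, (k i : ℂ) * c i) * k l / ∑ j, (k j : ℂ) ^ 2 := by
    simp only [lerayVec, mul_sub, Finset.sum_sub_distrib, mul_ite, mul_one, mul_zero,
      Finset.sum_ite_eq', Finset.mem_univ, if_true]
    rw [Finset.sum_mul, Finset.sum_div]
    congr 1
    exact Finset.sum_congr rfl fun i _ => by ring
  rw [e, hc]
  simp

lemma lerayVec_symm (k : Freq) (i l : Fin 3) : lerayVec k i l = lerayVec k l i := by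
  simp only [lerayVec, eq_comm (a := i), mul_comm (k i : ℂ)]

lemma conj_lerayVec (k : Freq) (i l : Fin 3) : starRingEnd ℂ (lerayVec k i l) = lerayVec k i l := by
  simp only [lerayVec, map_sub, map_div₀, map_mul, map_sum, map_pow, map_intCast]
  split_ifs <;> simp

/-- The rate at which the nonlinearity drives the mode `(k, i)`, tested against `c ∈ ℂ`. -/
def modeRate (f : L2Field) (k : Freq) (i : Fin 3) (c : ℂ) : ℝ :=
  transport f f {k} fun _ l => c * lerayVec k i l

lemma modeRate_eq (f : L2Field) (k : Freq) (i : Fin 3) (c : ℂ) :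
    modeRate f k i c =
      (c * ∑ j, ∑ l, derivCoeff j k * lerayVec k i l * productMode f f j l k).re := by
  rw [modeRate, transport_eq, Finset.sum_singleton, Finset.mul_sum]
  congr 1
  refine Finset.sum_congr rfl fun j _ => ?_
  rw [Finset.mul_sum]
  exact Finset.sum_congr rfl fun l _ => by ring

lemma modeRate_eq_re_im (f : L2Field) (k : Freq) (i : Fin 3) (c : ℂ) :
    modeRate f k i c = c.re * modeRate f k i 1 + c.im * modeRate f k i Complex.I := by
  simp only [modeRate_eq, Complex.mul_re, Complex.one_re, Complex.one_im, Complex.I_re,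
    Complex.I_im]
  ring

/-- Coefficients orthogonal to k are fixed by the projection, so the transport term decouples into
single-mode rates. Read backwards, it reassembles the derivatives of the modes into transport terms.
-/
lemma transport_eq_sum_modeRate (f : L2Field) (S : Finset Freq) (r : Freq → ℝ)
    {c : Freq → Fin 3 → ℂ} (hc : ∀ k ∈ S, ∑ i, (k i : ℂ) * c k i = 0) :
    transport f f S (fun k i => (r k : ℂ) * c k i) =
      ∑ k ∈ S, r k * ∑ i, modeRate f k i (c k i) := by
  rw [transport_eq, Complex.re_sum]
  refine Finset.sum_congr rfl fun k hk => ?_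
  simp only [modeRate_eq]
  rw [← Complex.re_sum, ← Complex.re_ofReal_mul]
  congr 1
  have e : ∀ j, ∑ l, derivCoeff j k * ((r k : ℂ) * c k l) * productMode f f j l k =
      ∑ l, ∑ i, (r k : ℂ) * (c k i * (derivCoeff j k * lerayVec k i l * productMode f f j l k)) := by
    intro j
    refine Finset.sum_congr rfl fun l _ => ?_
    rw [← sum_mul_lerayVec_of_orthogonal (hc k hk) l, Finset.mul_sum, Finset.mul_sum,
      Finset.sum_mul]
    exact Finset.sum_congr rfl fun i _ => by ring
  simp only [e, Finset.mul_sum]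
  exact (Finset.sum_congr rfl fun j _ => Finset.sum_comm).trans Finset.sum_comm

/-- `1 + α²·4π²|k|²`, the symbol of `1 - α²Δ`. -/
def voigtSymbol (α : ℝ) (k : Freq) : ℝ := 1 + α ^ 2 * laplaceEigenvalue k

lemma voigtSymbol_pos (α : ℝ) (k : Freq) : 0 < voigtSymbol α k := by
  have := laplaceEigenvalue_nonneg k
  unfold voigtSymbol
  positivity

variable {α β s s' T : ℝ} {u₀ v₀ : L2Field} {u v : ℝ → L2Field}

/-- The test field has the single frequency k and direction the projection of eᵢ. On it 1-α²Δ is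
multiplication by the symbol, and the projection can be dropped because u is divergence-free. -/
lemma IsSolution.hasDerivWithinAt_mode (hu : IsSolution α s T u₀ u) (k : Freq) (i : Fin 3) (c : ℂ)
    {t : ℝ} (ht : t ∈ Icc 0 T) :
    HasDerivWithinAt (fun τ => (c * starRingEnd ℂ (hat (u τ) i k)).re)
      (modeRate (u t) k i c / voigtSymbol α k) (Icc 0 T) t := by
  have hφ : IsTestField (trigField {k} fun _ l => c * lerayVec k i l) := by
    refine isTestField_trigField fun k' hk' => ?_
    rw [Finset.mem_singleton.1 hk']
    simp only [mul_left_comm _ c, ← Finset.mul_sum, sum_mul_lerayVec, mul_zero]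
  have e : ∀ x, trigField {k} (fun _ l => c * lerayVec k i l) x -
      α ^ 2 • laplacian (trigField {k} fun _ l => c * lerayVec k i l) x =
      trigField {k} (fun _ l => (voigtSymbol α k : ℂ) * (c * lerayVec k i l)) x := by
    intro x
    rw [laplacian_trigField]
    ext l
    simp only [PiLp.sub_apply, PiLp.smul_apply, trigField_apply, trigPoly, Finset.sum_singleton,
      smul_eq_mul, ← Complex.re_ofReal_mul, ← Complex.sub_re, voigtSymbol]
    congr 1
    push_cast
    ring
  have h := (hu.momentum _ hφ t ht).div_const (voigtSymbol α k)
  simp only [e, integral_inner_trigField, Finset.sum_singleton] at h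
  have hmode : ∀ τ ∈ Icc 0 T, (c * starRingEnd ℂ (hat (u τ) i k)).re =
      (∑ l, (voigtSymbol α k : ℂ) * (c * lerayVec k i l) * starRingEnd ℂ (hat (u τ) l k)).re /
        voigtSymbol α k := by
    intro τ hτ
    rw [eq_div_iff (voigtSymbol_pos α k).ne', mul_comm, ← Complex.re_ofReal_mul,
      ← sum_mul_lerayVec_of_orthogonal ((hu.divFree τ hτ).sum_mul_hat k) i, map_sum,
      Finset.mul_sum, Finset.mul_sum]
    congr 1
    refine Finset.sum_congr rfl fun l _ => ?_
    rw [map_mul, conj_lerayVec, lerayVec_symm k l i]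
    ring
  exact h.congr hmode (hmode t ht)

/-- The truncated pairing `∑_{k ∈ S} mₖ û(k)·v̂(k)` of two real fields. -/
def modalPairing (S : Finset Freq) (m : Freq → ℝ) (f g : L2Field) : ℝ :=
  ∑ k ∈ S, m k * ∑ i, (hat f i k * starRingEnd ℂ (hat g i k)).re

/-- Product rule for the mode equations. Two parameters α and β are allowed so that a Voigt solution
can be paired with an Euler one. -/
lemma IsSolution.hasDerivWithinAt_modalPairing (hu : IsSolution α s T u₀ u)
    (hv : IsSolution β s' T v₀ v) (S : Finset Freq) (m : Freq → ℝ) {t : ℝ} (ht : t ∈ Icc 0 T) :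
    HasDerivWithinAt (fun τ => modalPairing S m (u τ) (v τ))
      (transport (u t) (u t) S (fun k i => ((m k / voigtSymbol α k : ℝ) : ℂ) * hat (v t) i k) +
        transport (v t) (v t) S (fun k i => ((m k / voigtSymbol β k : ℝ) : ℂ) * hat (u t) i k))
      (Icc 0 T) t := by
  -- Testing with 1 and i gives real and imaginary parts, so the product rule is needed only for
  -- real functions.
  have hre : ∀ z w : ℂ, (z * starRingEnd ℂ w).re =
      (1 * starRingEnd ℂ z).re * (1 * starRingEnd ℂ w).re +
        (Complex.I * starRingEnd ℂ z).re * (Complex.I * starRingEnd ℂ w).re := by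
    intro z w
    simp
  rw [transport_eq_sum_modeRate _ _ _ fun k _ => (hv.divFree t ht).sum_mul_hat k,
    transport_eq_sum_modeRate _ _ _ fun k _ => (hu.divFree t ht).sum_mul_hat k,
    ← Finset.sum_add_distrib]
  refine HasDerivWithinAt.fun_sum fun k _ => ?_
  have hi : ∀ i ∈ (Finset.univ : Finset (Fin 3)), HasDerivWithinAt
      (fun τ => (hat (u τ) i k * starRingEnd ℂ (hat (v τ) i k)).re)
      (modeRate (u t) k i (hat (v t) i k) / voigtSymbol α k +
        modeRate (v t) k i (hat (u t) i k) / voigtSymbol β k) (Icc 0 T) t := by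
    intro i _
    simp only [hre (hat _ i k)]
    convert! ((hu.hasDerivWithinAt_mode k i 1 ht).fun_mul (hv.hasDerivWithinAt_mode k i 1 ht)).fun_add
      ((hu.hasDerivWithinAt_mode k i Complex.I ht).fun_mul
        (hv.hasDerivWithinAt_mode k i Complex.I ht)) using 1
    rw [modeRate_eq_re_im (u t), modeRate_eq_re_im (v t)]
    simp
    ring
  convert! (HasDerivWithinAt.fun_sum hi).const_mul (m k) using 1
  rw [Finset.sum_add_distrib, ← Finset.sum_div, ← Finset.sum_div]
  ring

/-! ### Uniform Sobolev bounds on the time interval -/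

lemma sobolevSq_le_of_le_add {u v w : L2Field}
    (h : ∀ i k, ‖hat u i k‖ₑ ≤ ‖hat v i k‖ₑ + ‖hat w i k‖ₑ) (m : ℕ) :
    sobolevSq m u ≤ 2 * (sobolevSq m v + sobolevSq m w) := by
  have hsq : ∀ x y : ℝ≥0∞, (x + y) ^ 2 ≤ 2 * (x ^ 2 + y ^ 2) := fun x y => by
    have := tsum_sq_le_of_sq_le (f := fun b : Bool => if b then y else x) (a := fun _ => 1)
      (b := fun b => if b then y ^ 2 else x ^ 2) fun b => by cases b <;> simp
    simpa [tsum_fintype, one_add_one_eq_two, add_comm] using this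
  simp only [sobolevSq]
  rw [← ENNReal.tsum_add, ← ENNReal.tsum_mul_left]
  refine ENNReal.tsum_le_tsum fun k => ?_
  rw [← mul_add, mul_left_comm]
  refine mul_le_mul_right ?_ _
  simp only [fourierSq_eq]
  rw [← Finset.sum_add_distrib, Finset.mul_sum]
  exact Finset.sum_le_sum fun i _ => (pow_le_pow_left' (h i k) 2).trans (hsq _ _)

lemma sobolevSq_sub_le (m : ℕ) (u v : L2Field) :
    sobolevSq m (u - v) ≤ 2 * (sobolevSq m u + sobolevSq m v) :=
  sobolevSq_le_of_le_add (fun i k => by rw [hat_sub]; exact enorm_sub_le) m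

lemma sobolevSq_le_sub_add (m : ℕ) (u v : L2Field) :
    sobolevSq m u ≤ 2 * (sobolevSq m (u - v) + sobolevSq m v) :=
  sobolevSq_le_of_le_add (fun i k => by
    rw [hat_sub]
    simpa using enorm_add_le (hat u i k - hat v i k) (hat v i k)) m

/-- Continuity in Hᵐ gives a finite bound near each time, and compactness of the interval makes it
uniform. -/
lemma IsSolution.exists_sobolevSq_le {m : ℕ} (hu : IsSolution α m T u₀ u) :
    ∃ K : ℝ≥0∞, K ≠ ⊤ ∧ ∀ t ∈ Icc 0 T, sobolevSq m (u t) ≤ K := by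
  refine isCompact_Icc.induction_on
    (p := fun A => ∃ K : ℝ≥0∞, K ≠ ⊤ ∧ ∀ t ∈ A, sobolevSq m (u t) ≤ K) ?_ ?_ ?_ ?_
  · exact ⟨0, by simp, by simp⟩
  · rintro A B hAB ⟨K, hK, h⟩
    exact ⟨K, hK, fun t ht => h t (hAB ht)⟩
  · rintro A B ⟨K, hK, h⟩ ⟨K', hK', h'⟩
    refine ⟨K + K', ENNReal.add_ne_top.2 ⟨hK, hK'⟩, ?_⟩
    rintro t (ht | ht)
    · exact (h t ht).trans le_self_add
    · exact (h' t ht).trans le_add_self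
  · intro t₀ ht₀
    have hfin : sobolevSq m (u t₀) ≠ ⊤ := by
      rw [← sobolevNorm_sq]
      exact ENNReal.pow_ne_top (hu.mem t₀ ht₀).ne
    refine ⟨{t | sobolevNorm m (u t - u t₀) < 1},
      (hu.cont t₀ ht₀).eventually (gt_mem_nhds zero_lt_one), 2 * (1 + sobolevSq m (u t₀)),
      ENNReal.mul_ne_top (by simp) (ENNReal.add_ne_top.2 ⟨by simp, hfin⟩), fun t ht => ?_⟩
    refine (sobolevSq_le_sub_add m (u t) (u t₀)).trans ?_
    gcongr
    rw [← sobolevNorm_sq]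
    exact pow_le_one₀ zero_le (le_of_lt ht)

/-- A linear differential inequality. -/
lemma le_mul_exp_of_hasDerivWithinAt_le {f f' : ℝ → ℝ} {A D : ℝ} (hA : 0 ≤ A) (hD : 0 ≤ D)
    (hf : ∀ t ∈ Icc 0 T, HasDerivWithinAt f (f' t) (Icc 0 T) t)
    (hle : ∀ t ∈ Icc 0 T, f' t ≤ A * f t + D) {t : ℝ} (ht : t ∈ Icc 0 T) :
    f t ≤ (f 0 + D * t) * Real.exp (A * t) := by
  -- The integrating factor makes exp(-At)f - Dt nonincreasing. No sign of f is needed, and the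
  -- relative energy has none.
  have hg : ∀ t ∈ Icc 0 T, HasDerivWithinAt (fun t => Real.exp (-(A * t)) * f t - D * t)
      (Real.exp (-(A * t)) * (f' t - A * f t) - D) (Icc 0 T) t := by
    intro t ht
    have h1 : HasDerivWithinAt (fun t : ℝ => Real.exp (-(A * t))) (Real.exp (-(A * t)) * -A)
        (Icc 0 T) t := by
      have := ((hasDerivAt_id t).const_mul A).neg.exp.hasDerivWithinAt (s := Icc 0 T)
      simpa using this
    have h2 := (h1.fun_mul (hf t ht)).fun_sub
      (((hasDerivAt_id t).const_mul D).hasDerivWithinAt (s := Icc 0 T))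
    convert! h2 using 1
    ring
  have hanti : AntitoneOn (fun t => Real.exp (-(A * t)) * f t - D * t) (Icc 0 T) := by
    refine antitoneOn_of_hasDerivWithinAt_nonpos (convex_Icc 0 T)
      (fun t ht => (hg t ht).continuousWithinAt)
      (fun t ht => (hg t (interior_subset ht)).mono interior_subset) fun t ht => ?_
    have ht := interior_subset ht
    have h1 : Real.exp (-(A * t)) ≤ 1 :=
      Real.exp_le_one_iff.2 (by nlinarith [mul_nonneg hA ht.1])
    have h2 : f' t - A * f t ≤ D := by linarith [hle t ht]
    nlinarith [mul_le_mul_of_nonneg_left h2 (Real.exp_pos (-(A * t))).le]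
  have h := hanti ⟨le_rfl, ht.1.trans ht.2⟩ ht ht.1
  simp only [mul_zero, neg_zero, Real.exp_zero, one_mul, sub_zero] at h
  have h3 : Real.exp (-(A * t)) * f t ≤ f 0 + D * t := by linarith
  calc f t = Real.exp (-(A * t)) * f t * Real.exp (A * t) := by
        rw [mul_right_comm, ← Real.exp_add]
        simp
    _ ≤ _ := mul_le_mul_of_nonneg_right h3 (Real.exp_pos _).le

/-! ### The relative energy estimate -/

/-- The frequencies outside of `S` are negligible for fields whose `H¹` norm is at most `√M`. -/
structure NegligibleTails (S : Finset Freq) (M : ℝ≥0∞) (ε : ℝ) : Prop where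
  transport_le : ∀ f g h : L2Field, sobolevSq 1 f ≤ M → sobolevSq 1 g ≤ M → sobolevSq 1 h ≤ M →
    |transport f (g - proj S g) S fun k i => hat h i k| ≤ ε
  sobolevSq_zero_le : ∀ f : L2Field, sobolevSq 1 f ≤ M →
    sobolevSq 0 f ≤ (∑ k ∈ S, fourierSq f k) + ENNReal.ofReal ε

lemma exists_negligibleTails (S₀ : Finset Freq) {M : ℝ≥0∞} (hM : M ≠ ⊤) {ε : ℝ} (hε : 0 < ε) :
    ∃ S, S₀ ⊆ S ∧ NegligibleTails S M ε := by
  have hdiv : ∀ {A B : ℝ≥0∞}, A ≠ ⊤ → B / (A + 1) * A ≤ B := fun {A B} hA => by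
    calc B / (A + 1) * A ≤ B / (A + 1) * (A + 1) := by gcongr; exact le_self_add
      _ = B := ENNReal.div_mul_cancel (by simp) (by simp [hA])
  -- The transport bound is for the square, hence ε²; the L² bound is linear, hence ε. The added
  -- ones in the denominators avoid division by zero.
  set B : ℝ≥0∞ := min (ENNReal.ofReal ε ^ 2) (ENNReal.ofReal ε) with hB
  set A : ℝ≥0∞ := 81 * (M * M * M) + M with hA
  have hBpos : 0 < B := lt_min (by simpa [pos_iff_ne_zero] using hε) (by simpa using hε)
  have hAtop : A ≠ ⊤ := by simp [hA, ENNReal.mul_eq_top, hM]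
  set c : ℝ≥0∞ := B / (A + 1) with hc
  have hcpos : 0 < c := ENNReal.div_pos hBpos.ne' (by simp [hAtop])
  have hcA : c * A ≤ B := hdiv hAtop
  obtain ⟨S, hS₀, hS, hη⟩ := exists_latticeTail_le S₀ (η := c ^ 2 / (latticeTail ∅ + 1))
    (ENNReal.div_pos (pow_ne_zero 2 hcpos.ne') (by simp [latticeTail_empty_ne_top]))
  have h1 : latticeTail ∅ * latticeTail S ≤ c ^ 2 := by
    rw [mul_comm]
    exact (mul_le_mul_left hη _).trans (hdiv latticeTail_empty_ne_top)
  have h2 : latticeTail S ≤ c ^ 2 :=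
    hη.trans (ENNReal.div_le_of_le_mul' (le_mul_of_one_le_left' le_add_self))
  refine ⟨S, hS₀, ⟨fun f g h hf hg hh => ?_, fun f hf => ?_⟩⟩
  · have hhat : ∀ i k, hat (g - proj S g) i k = if k ∈ S then 0 else hat g i k := by
      intro i k
      rw [hat_sub, hat_proj hS]
      split_ifs <;> simp
    have h3 := enorm_transport_sq_le_of_hat_eq_zero (f := f) (g := g - proj S g) h
      (fun l hl i => by rw [hhat, if_pos hl]) h1
    have h4 : sobolevSq 1 (g - proj S g) ≤ M := by
      refine (sobolevSq_le (fun i k => ?_) 1).trans hg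
      rw [hhat]
      split_ifs <;> simp
    have h5 : ‖transport f (g - proj S g) S fun k i => hat h i k‖ₑ ^ 2 ≤
        ENNReal.ofReal ε ^ 2 := by
      refine h3.trans (le_trans ?_ (hcA.trans (min_le_left _ _)))
      refine mul_le_mul_right ?_ _
      refine le_trans ?_ le_self_add
      gcongr
    rw [ENNReal.pow_le_pow_left_iff two_ne_zero, ← ofReal_norm,
      ENNReal.ofReal_le_ofReal_iff hε.le] at h5
    exact h5
  · refine (EulerVoigt.sobolevSq_zero_le h2 f).trans ?_
    gcongr
    refine le_trans ?_ (hcA.trans (min_le_right _ _))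
    exact mul_le_mul_right (hf.trans le_add_self) _

lemma transport_proj_antisymm {f : L2Field} (hf : IsDivFree f) (S : Finset Freq) (g h : L2Field) :
    transport f (proj S g) S (fun k i => hat h i k) =
      -transport f (proj S h) S fun k i => hat g i k :=
  transport_trigLp_antisymm hf S _ _

/-- The truncated part of f cancels by antisymmetry and only a tail remains: energy conservation up
to ε for a field in H¹. -/
lemma NegligibleTails.abs_transport_self_le {S : Finset Freq} {M : ℝ≥0∞} {ε : ℝ}
    (hS : NegligibleTails S M ε) {f : L2Field} (hf : IsDivFree f) (hfM : sobolevSq 1 f ≤ M) :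
    |transport f f S fun k i => hat f i k| ≤ ε := by
  have h := hS.transport_le f f f hfM hfM hfM
  rw [transport_sub_right] at h
  have h0 := transport_proj_antisymm hf S f f
  rwa [show transport f (proj S f) S (fun k i => hat f i k) = 0 by linarith, sub_zero] at h

/-- The cross terms of the relative energy reduce to a term quadratic in the difference. -/
lemma NegligibleTails.abs_transport_cross_le {S : Finset Freq} {M : ℝ≥0∞} {ε : ℝ}
    (hS : NegligibleTails S M ε) {f g : L2Field} (hf : IsDivFree f) (hg : IsDivFree g)
    (hfM : sobolevSq 1 f ≤ M) (hgM : sobolevSq 1 g ≤ M) (hfgM : sobolevSq 1 (f - g) ≤ M) :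
    |transport f f S (fun k i => hat g i k) + transport g g S (fun k i => hat f i k) -
      transport (f - g) (f - g) S fun k i => hat g i k| ≤ 3 * ε := by
  -- With b(f,g,h) for the transport term tested against h, the expression equals b(g,g,f) +
  -- b(g,f,g) + b(f-g,g,g). Antisymmetry cancels the truncated parts and leaves three tails.
  have h1 := hS.transport_le g g f hgM hgM hfM
  have h2 := hS.transport_le g f g hgM hfM hgM
  have h3 := hS.transport_le (f - g) g g hfgM hgM hgM
  have a1 := transport_proj_antisymm hg S g f
  have a2 := transport_proj_antisymm hf S g g
  have a3 := transport_proj_antisymm hg S g g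
  simp only [transport_sub_right, transport_sub_left] at h1 h2 h3 ⊢
  rw [abs_le] at *
  constructor <;> linarith [h1.1, h1.2, h2.1, h2.2, h3.1, h3.2]

/-! ### Truncated quadratic forms and the relative energy. -/

lemma sum_mul_fourierSq_eq (S : Finset Freq) {m : Freq → ℝ} (hm : ∀ k, 0 ≤ m k) (f : L2Field) :
    ∑ k ∈ S, ENNReal.ofReal (m k) * fourierSq f k = ENNReal.ofReal (modalPairing S m f f) := by
  have hz : ∀ z : ℂ, (z * starRingEnd ℂ z).re = ‖z‖ ^ 2 := fun z => by
    rw [Complex.mul_conj, Complex.ofReal_re, Complex.normSq_eq_norm_sq]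
  simp only [modalPairing, hz]
  rw [ENNReal.ofReal_sum_of_nonneg fun k _ => mul_nonneg (hm k) (by positivity)]
  refine Finset.sum_congr rfl fun k _ => ?_
  rw [ENNReal.ofReal_mul (hm k), ENNReal.ofReal_sum_of_nonneg fun i _ => by positivity, fourierSq_eq]
  congr 1
  refine Finset.sum_congr rfl fun i _ => ?_
  rw [ENNReal.ofReal_pow (norm_nonneg _), ofReal_norm]

lemma modalPairing_self_nonneg (S : Finset Freq) {m : Freq → ℝ} (hm : ∀ k, 0 ≤ m k) (f : L2Field) :
    0 ≤ modalPairing S m f f := by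
  refine Finset.sum_nonneg fun k _ => mul_nonneg (hm k) (Finset.sum_nonneg fun i _ => ?_)
  rw [Complex.mul_conj, Complex.ofReal_re]
  exact Complex.normSq_nonneg _

lemma modalPairing_sub_self (S : Finset Freq) (m : Freq → ℝ) (f g : L2Field) :
    modalPairing S m (f - g) (f - g) =
      modalPairing S m f f + modalPairing S m g g - 2 * modalPairing S m f g := by
  simp only [modalPairing, Finset.mul_sum, ← Finset.sum_add_distrib, ← Finset.sum_sub_distrib]
  refine Finset.sum_congr rfl fun k _ => Finset.sum_congr rfl fun i _ => ?_
  simp only [hat_sub, map_sub, Complex.mul_re, Complex.sub_re, Complex.sub_im, Complex.conj_re,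
    Complex.conj_im]
  ring

/-- Young's inequality from |f̂-2ĝ|² ≥ 0, weighted so that half of the f term survives when the
cross term is absorbed in `le_relativeEnergy`. -/
lemma two_mul_modalPairing_le (S : Finset Freq) {m : Freq → ℝ} (hm : ∀ k, 0 ≤ m k)
    (f g : L2Field) :
    2 * modalPairing S m f g ≤ modalPairing S m f f / 2 + 2 * modalPairing S m g g := by
  simp only [modalPairing, Finset.mul_sum, Finset.sum_div, ← Finset.sum_add_distrib]
  refine Finset.sum_le_sum fun k _ => Finset.sum_le_sum fun i _ => ?_
  simp only [Complex.mul_re, Complex.conj_re, Complex.conj_im]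
  have h := mul_nonneg (hm k) (add_nonneg (sq_nonneg ((hat f i k).re - 2 * (hat g i k).re))
    (sq_nonneg ((hat f i k).im - 2 * (hat g i k).im)))
  nlinarith

lemma modalPairing_voigtSymbol (S : Finset Freq) (α : ℝ) (f g : L2Field) :
    modalPairing S (voigtSymbol α) f g =
      modalPairing S 1 f g + α ^ 2 * modalPairing S laplaceEigenvalue f g := by
  simp only [modalPairing, voigtSymbol, Pi.one_apply]
  rw [Finset.mul_sum, ← Finset.sum_add_distrib]
  exact Finset.sum_congr rfl fun k _ => by ring

lemma transport_voigtSymbol (f g h : L2Field) (S : Finset Freq) (α : ℝ) :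
    transport f g S (fun k i => (voigtSymbol α k : ℂ) * hat h i k) =
      transport f g S (fun k i => hat h i k) +
        α ^ 2 * transport f g S fun k i => (laplaceEigenvalue k : ℂ) * hat h i k := by
  simp only [transport_eq]
  rw [← Complex.re_ofReal_mul, ← Complex.add_re, Finset.mul_sum, ← Finset.sum_add_distrib]
  congr 1
  refine Finset.sum_congr rfl fun k _ => ?_
  rw [Finset.mul_sum, ← Finset.sum_add_distrib]
  refine Finset.sum_congr rfl fun j _ => ?_
  rw [Finset.mul_sum, ← Finset.sum_add_distrib]
  refine Finset.sum_congr rfl fun i _ => ?_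
  simp only [voigtSymbol]
  push_cast
  ring

/-- The truncated relative energy of a Voigt field `f` and an Euler field `g`, up to a term
depending on `g` only. -/
def relativeEnergy (S : Finset Freq) (α : ℝ) (f g : L2Field) : ℝ :=
  modalPairing S (voigtSymbol α) f f + modalPairing S 1 g g -
    2 * modalPairing S (voigtSymbol α) f g

lemma le_relativeEnergy (S : Finset Freq) (α : ℝ) (f g : L2Field) :
    modalPairing S 1 (f - g) (f - g) + α ^ 2 / 2 * modalPairing S laplaceEigenvalue f f ≤
      relativeEnergy S α f g + 2 * α ^ 2 * modalPairing S laplaceEigenvalue g g := by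
  have h := mul_le_mul_of_nonneg_left
    (two_mul_modalPairing_le S laplaceEigenvalue_nonneg f g) (sq_nonneg α)
  rw [relativeEnergy, modalPairing_sub_self, modalPairing_voigtSymbol, modalPairing_voigtSymbol]
  linarith

/-- The value is -α² times the truncated ‖∇f‖², so a common initial datum contributes nothing
positive to the Gronwall bound. -/
lemma relativeEnergy_self_nonpos (S : Finset Freq) (α : ℝ) (f : L2Field) :
    relativeEnergy S α f f ≤ 0 := by
  have h := mul_nonneg (sq_nonneg α)
    (modalPairing_self_nonneg S laplaceEigenvalue_nonneg f)
  rw [relativeEnergy, modalPairing_voigtSymbol]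
  linarith

/-- The weight cancels the symbol of the Voigt equation. On the Euler side it stays on u as 1-α²Δ,
which produces the only term carrying α². -/
lemma IsSolution.hasDerivWithinAt_relativeEnergy (hu : IsSolution α s T u₀ u)
    (hv : IsSolution 0 s' T v₀ v) (S : Finset Freq) {t : ℝ} (ht : t ∈ Icc 0 T) :
    HasDerivWithinAt (fun τ => relativeEnergy S α (u τ) (v τ))
      (2 * transport (u t) (u t) S (fun k i => hat (u t) i k) +
        2 * transport (v t) (v t) S (fun k i => hat (v t) i k) -
        2 * (transport (u t) (u t) S (fun k i => hat (v t) i k) +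
          (transport (v t) (v t) S (fun k i => hat (u t) i k) + α ^ 2 *
            transport (v t) (v t) S fun k i => (laplaceEigenvalue k : ℂ) * hat (u t) i k)))
      (Icc 0 T) t := by
  have h := ((hu.hasDerivWithinAt_modalPairing hu S (voigtSymbol α) ht).fun_add
    (hv.hasDerivWithinAt_modalPairing hv S 1 ht)).fun_sub
      ((hu.hasDerivWithinAt_modalPairing hv S (voigtSymbol α) ht).const_mul 2)
  have h0 : ∀ k, voigtSymbol 0 k = 1 := fun k => by simp [voigtSymbol]
  simp only [h0, div_self (voigtSymbol_pos α _).ne', Pi.one_apply, div_one, Complex.ofReal_one,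
    one_mul, transport_voigtSymbol] at h
  convert! h using 1
  ring

/-- As long as the strong Euler solution exists, the gradients of the Euler–Voigt solutions are
bounded uniformly in `α`. -/
theorem exists_gradNorm_le (hT : 0 ≤ T) (hv : IsStrongEulerSolution T u₀ v) :
    ∃ C : ℝ≥0∞, C ≠ ⊤ ∧ ∀ α > 0, ∀ u, IsEulerVoigtSolution α T u₀ u →
      ∀ t ∈ Icc 0 T, gradNorm (u t) ≤ C := by
  have hv' : IsSolution 0 ((3 : ℕ) : ℝ) T u₀ v := by exact_mod_cast hv
  obtain ⟨K, hK, hvK⟩ := hv'.exists_sobolevSq_le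
  -- All constants depend only on T and the H³ bound K of v. Λ controls the gradient series of v,
  -- and D the pairing with the Laplacian.
  set Λ : ℝ := Real.sqrt (latticeTail ∅ * (9 * K)).toReal with hΛ
  set D : ℝ := (1296 * latticeTail ∅ * K ^ 2).toReal with hD
  have hτ := latticeTail_empty_ne_top
  have hΛK : latticeTail ∅ * (9 * K) ≤ ENNReal.ofReal Λ ^ 2 := by
    rw [← ENNReal.ofReal_pow (Real.sqrt_nonneg _), Real.sq_sqrt ENNReal.toReal_nonneg,
      ENNReal.ofReal_toReal (by simp [ENNReal.mul_eq_top, hτ, hK])]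
  have hDK : 1296 * latticeTail ∅ * K ^ 2 = ENNReal.ofReal D :=
    (ENNReal.ofReal_toReal (by simp [ENNReal.mul_eq_top, hτ, hK])).symm
  have hΛ0 : 0 ≤ Λ := Real.sqrt_nonneg _
  have hD0 : 0 ≤ D := ENNReal.toReal_nonneg
  have hK0 : 0 ≤ K.toReal := ENNReal.toReal_nonneg
  -- 6Λ absorbs the quadratic term and 2 absorbs α²‖∇u‖², of which the relative energy controls
  -- half. In E, 10 = 2 + 2 + 2·3 counts the tail errors.
  set A : ℝ := 6 * Λ + 2 with hA
  set E : ℝ := A * (2 * K.toReal) + (10 + 6 * Λ) + D with hE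
  have hA0 : 0 ≤ A := by positivity
  have hE0 : 0 ≤ E := by positivity
  set R : ℝ := 2 * (E * T * Real.exp (A * T) + 2 * K.toReal) with hR
  refine ⟨ENNReal.ofReal R ^ (1 / 2 : ℝ), ENNReal.rpow_ne_top_of_nonneg (by norm_num)
    ENNReal.ofReal_ne_top, fun α hα u hu t ht => ?_⟩
  have hu' : IsSolution α ((1 : ℕ) : ℝ) T u₀ u := by exact_mod_cast hu
  obtain ⟨K', hK', huK'⟩ := hu'.exists_sobolevSq_le
  refine ENNReal.rpow_le_rpow ?_ (by norm_num)
  rw [ENNReal.tsum_eq_iSup_sum]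
  refine iSup_le fun S₀ => ?_
  have hα2 : 0 < α ^ 2 := by positivity
  -- Tolerance α² puts the truncation errors at the order of the main estimate. The bound K' may
  -- depend on α and u, but it affects only the choice of S.
  obtain ⟨S, hS₀, hS⟩ := exists_negligibleTails S₀ (M := K + K' + 2 * (K' + K))
    (by simp [ENNReal.mul_eq_top, hK, hK']) hα2
  refine (Finset.sum_le_sum_of_subset hS₀).trans ?_
  rw [sum_mul_fourierSq_eq S laplaceEigenvalue_nonneg]
  apply ENNReal.ofReal_le_ofReal
  have hvgrad : ∀ t ∈ Icc 0 T, modalPairing S laplaceEigenvalue (v t) (v t) ≤ K.toReal := by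
    intro t ht
    rw [← ENNReal.ofReal_le_iff_le_toReal hK, ← sum_mul_fourierSq_eq S laplaceEigenvalue_nonneg]
    exact (sum_laplaceEigenvalue_mul_le S _).trans
      ((sobolevSq_mono (by norm_num) _).trans (hvK t ht))
  have hrate : ∀ t ∈ Icc 0 T,
      2 * transport (u t) (u t) S (fun k i => hat (u t) i k) +
        2 * transport (v t) (v t) S (fun k i => hat (v t) i k) -
        2 * (transport (u t) (u t) S (fun k i => hat (v t) i k) +
          (transport (v t) (v t) S (fun k i => hat (u t) i k) + α ^ 2 *
            transport (v t) (v t) S fun k i => (laplaceEigenvalue k : ℂ) * hat (u t) i k)) ≤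
      A * relativeEnergy S α (u t) (v t) + α ^ 2 * E := by
    intro t ht
    have huM : sobolevSq 1 (u t) ≤ K + K' + 2 * (K' + K) :=
      (huK' t ht).trans (le_add_self.trans le_self_add)
    have hv1 : sobolevSq 1 (v t) ≤ K := (sobolevSq_mono (by norm_num) _).trans (hvK t ht)
    have hvM : sobolevSq 1 (v t) ≤ K + K' + 2 * (K' + K) :=
      hv1.trans (le_self_add.trans le_self_add)
    have hwM : sobolevSq 1 (u t - v t) ≤ K + K' + 2 * (K' + K) := by
      refine (sobolevSq_sub_le 1 _ _).trans (le_trans ?_ le_add_self)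
      gcongr
      exact huK' t ht
    have b1 := hS.abs_transport_self_le (hu'.divFree t ht) huM
    have b2 := hS.abs_transport_self_le (hv'.divFree t ht) hvM
    have b3 := hS.abs_transport_cross_le (hu'.divFree t ht) (hv'.divFree t ht) huM hvM hwM
    have hp := modalPairing_self_nonneg S (m := 1) (fun _ => zero_le_one) (u t - v t)
    have hg := modalPairing_self_nonneg S laplaceEigenvalue_nonneg (u t)
    have b4 : |transport (u t - v t) (u t - v t) S fun k i => hat (v t) i k| ≤
        Λ * (3 * (modalPairing S 1 (u t - v t) (u t - v t) + α ^ 2)) := by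
      have h1 := enorm_transport_le_of_sobolev_three S (u t - v t) (v t) (Λ := ENNReal.ofReal Λ)
        ((mul_le_mul_right (mul_le_mul_right (hvK t ht) _) _).trans hΛK)
      have h2 := hS.sobolevSq_zero_le (u t - v t) hwM
      have h3 := sum_mul_fourierSq_eq S (m := 1) (fun _ => zero_le_one) (u t - v t)
      simp only [Pi.one_apply, ENNReal.ofReal_one, one_mul] at h3
      rw [h3, ← ENNReal.ofReal_add hp hα2.le] at h2
      have h4 := h1.trans (mul_le_mul_right (mul_le_mul_right h2 _) _)
      rwa [show (3 : ℝ≥0∞) = ENNReal.ofReal 3 by simp, ← ENNReal.ofReal_mul (by norm_num),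
        ← ENNReal.ofReal_mul hΛ0, ← ofReal_norm,
        ENNReal.ofReal_le_ofReal_iff (by positivity)] at h4
    have b5 : |transport (v t) (v t) S fun k i => (laplaceEigenvalue k : ℂ) * hat (u t) i k| ≤
        (D + modalPairing S laplaceEigenvalue (u t) (u t)) / 2 := by
      have h1 := enorm_transport_laplacian_sq_le S (v t) (u t)
      rw [sum_mul_fourierSq_eq S laplaceEigenvalue_nonneg] at h1
      have h2 := h1.trans (mul_le_mul_left
        (mul_le_mul_right (pow_le_pow_left' (hvK t ht) 2) _) _)
      rw [hDK, ← ENNReal.ofReal_mul hD0, ← ofReal_norm, ← ENNReal.ofReal_pow (norm_nonneg _),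
        ENNReal.ofReal_le_ofReal_iff (by positivity), Real.norm_eq_abs] at h2
      refine abs_le_of_sq_le_sq' ?_ (by positivity) |> fun h => abs_le.2 h
      rw [← sq_abs]
      nlinarith [sq_nonneg (D - modalPairing S laplaceEigenvalue (u t) (u t))]
    have hrel := le_relativeEnergy S α (u t) (v t)
    have hvgradt := mul_le_mul_of_nonneg_left (hvgrad t ht) (by positivity : 0 ≤ 2 * α ^ 2)
    have b6 := mul_le_mul_of_nonneg_left b5 hα2.le
    rw [← abs_of_pos hα2, ← abs_mul, abs_of_pos hα2] at b6
    set p := modalPairing S 1 (u t - v t) (u t - v t)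
    set g := modalPairing S laplaceEigenvalue (u t) (u t)
    set Z := relativeEnergy S α (u t) (v t)
    have b7 : 6 * Λ * p + α ^ 2 * g ≤ A * (Z + 2 * α ^ 2 * K.toReal) := by
      have h1 : p + α ^ 2 / 2 * g ≤ Z + 2 * α ^ 2 * K.toReal := by linarith
      have h2 := mul_le_mul_of_nonneg_left h1 hA0
      have h3 : 0 ≤ Λ * (α ^ 2 * g) := by positivity
      rw [hA] at h2 ⊢
      nlinarith
    rw [abs_le] at b1 b2 b3 b4 b6
    rw [hE]
    nlinarith [b1.2, b2.2, b3.1, b4.1, b6.1]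
  have hG := le_mul_exp_of_hasDerivWithinAt_le hA0 (by positivity : 0 ≤ α ^ 2 * E)
    (fun t ht => hu'.hasDerivWithinAt_relativeEnergy hv' S ht) hrate ht
  rw [hu'.initial, hv'.initial] at hG
  have hrel := le_relativeEnergy S α (u t) (v t)
  have hp := modalPairing_self_nonneg S (m := 1) (fun _ => zero_le_one) (u t - v t)
  have hvgradt := mul_le_mul_of_nonneg_left (hvgrad t ht) (by positivity : 0 ≤ 2 * α ^ 2)
  have h1 : (relativeEnergy S α u₀ u₀ + α ^ 2 * E * t) * Real.exp (A * t) ≤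
      α ^ 2 * (E * T * Real.exp (A * T)) := by
    calc _ ≤ (0 + α ^ 2 * E * T) * Real.exp (A * T) := by
          gcongr
          · exact relativeEnergy_self_nonpos S α u₀
          · exact ht.2
          · exact ht.2
      _ = _ := by ring
  have h2 : α ^ 2 * modalPairing S laplaceEigenvalue (u t) (u t) ≤ α ^ 2 * R := by
    rw [hR]
    linarith
  exact le_of_mul_le_mul_left h2 hα2

end EulerVoigt

end

/-! ### Conclusion: a uniform gradient bound forces α‖∇u‖ → 0. -/

theorem theorem4 (s : ℝ) (hs : 3 ≤ s)
    (u₀ : EulerVoigt.L2Field) (hu₀ : EulerVoigt.MemSobolev s u₀)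
    (hdiv : EulerVoigt.IsDivFree u₀)
    (T : ℝ) (hT : 0 < T)
    (u : ℝ → ℝ → EulerVoigt.L2Field)
    (hu : ∀ α : ℝ, 0 < α → EulerVoigt.IsEulerVoigtSolution α T u₀ (u α))
    (hlim : 0 < limsup
      (fun α : ℝ => ⨆ t ∈ Icc (0 : ℝ) T, ENNReal.ofReal α * EulerVoigt.gradNorm (u α t))
      (𝓝[>] (0 : ℝ))) :
    EulerVoigt.DevelopsSingularityWithin u₀ T := by
  rintro ⟨v, hv⟩
  obtain ⟨C, hC, hle⟩ := EulerVoigt.exists_gradNorm_le hT.le hv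
  have hbound : ∀ᶠ α in 𝓝[>] (0 : ℝ),
      ⨆ t ∈ Icc (0 : ℝ) T, ENNReal.ofReal α * EulerVoigt.gradNorm (u α t) ≤
        ENNReal.ofReal α * C := by
    filter_upwards [self_mem_nhdsWithin] with α hα
    exact iSup₂_le fun t ht => mul_le_mul_right (hle α hα (u α) (hu α hα) t ht) _
  have htend : Tendsto (fun α : ℝ => ENNReal.ofReal α * C) (𝓝[>] 0) (𝓝 0) := by
    have h : Tendsto (fun α : ℝ => ENNReal.ofReal α * C) (𝓝 0) (𝓝 (ENNReal.ofReal 0 * C)) :=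
      ENNReal.Tendsto.mul_const (ENNReal.continuous_ofReal.tendsto 0) (Or.inr hC)
    rw [ENNReal.ofReal_zero, zero_mul] at h
    exact h.mono_left nhdsWithin_le_nhds
  exact hlim.not_ge ((limsup_le_limsup hbound).trans htend.limsup_eq.le)
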